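/- Let $G$ be a finite-dimensional real Lie group (smooth, Hausdorff and second countable, not necessarily connected). Let $\nabla$ be its canonical connection, that is, the connection on $TG$ with $\nabla_XY=\frac12[X,Y]$ for left-invariant vector fields $X,Y$, extended to arbitrary vector fields by linearity and the Leibniz rule. Suppose that the commutator subgroup $[G,G]$ is closed in $G$. Then $G/[G,G]$, with the quotient topology, carries a Lie group structure for which the projection $\pi:G\to G/[G,G]$ is a smooth submersion, and for this structure the following hold. (a) For every bi-invariant (smooth, invariant under all left and all right translations) one-form $\alpha$ on $G$ there is exactly one smooth one-form $\bar\alpha$ on $G/[G,G]$ with $\pi^*\bar\alpha=\alpha$. (b) $\nabla$ projects to a smooth connection $\bar\nabla$ on $G/[G,G]$: if the smooth vector fields $X,Y$ on $G$ are $\pi$-related to the smooth vector fields $\bar X,\bar Y$ on $G/[G,G]$, then $\nabla_XY$ is $\pi$-related to $\bar\nabla_{\bar X}\bar Y$. The connection $\bar\nabla$ is flat, that is, its curvature is zero. (c) If $\alpha^1,\dots,\alpha^k$ is a basis of the space of bi-invariant one-forms on $G$, then the induced one-forms $\bar\alpha^1,\dots,\bar\alpha^k$ comprise a flat coordinate system: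 around every point of $G/[G,G]$ there are smooth local coordinates $(x^1,\dots,x^k)$ with $\bar\alpha^i=dx^i$ for all $i$, in which all Christoffel symbols of $\bar\nabla$ vanish, that is, $\bar\nabla\,\partial/\partial x^i=0$ for all $i$. -/

import Mathlib

open Bundle VectorField
open scoped Manifold ContDiff Topology

noncomputable section

/-! ## One-forms -/

section OneForms

variable {E : Type*} [NormedAddCommGroup E] [NormedSpace ℝ E]
  {H : Type*} [TopologicalSpace H] (I : ModelWithCorners ℝ E H)
  {E' : Type*} [NormedAddCommGroup E'] [NormedSpace ℝ E']
  {H' : Type*} [TopologicalSpace H'] {I' : ModelWithCorners ℝ E' H'}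

/-- Smooth one-forms on `M`: smooth sections of the cotangent bundle. -/
abbrev OneForm (M : Type*) [TopologicalSpace M] [ChartedSpace H M] [IsManifold I ∞ M] :=
  ContMDiffSection I (E →L[ℝ] ℝ) ∞ (fun x : M ↦ TangentSpace I x →L[ℝ] Trivial M ℝ x)

variable {I}

/-- `f` pulls the one-form `β` on `N` back to the one-form `α` on `M`, that is,
`α x v = β (f x) (df v)` for all `x` and all tangent vectors `v` at `x`. -/
def IsPullback {M : Type*} [TopologicalSpace M] [ChartedSpace H M] [IsManifold I ∞ M]
    {N : Type*} [TopologicalSpace N] [ChartedSpace H' N] [IsManifold I' ∞ N]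
    (f : M → N) (β : OneForm I' N) (α : OneForm I M) : Prop :=
  ∀ (x : M) (v : TangentSpace I x), α x v = β (f x) (mfderiv I I' f x v)

variable (I) in
/-- The real vector space of bi-invariant one-forms on `G`: the smooth one-forms that are preserved
by pullback along every left translation and along every right translation. -/
def biInvariantOneForms (G : Type*) [TopologicalSpace G] [ChartedSpace H G] [Group G]
    [LieGroup I ∞ G] : Submodule ℝ (OneForm I G) where
  carrier := {α | ∀ h : G, IsPullback (fun x : G ↦ h * x) α α ∧ IsPullback (fun x : G ↦ x * h) α α}
  zero_mem' := fun _ ↦ ⟨fun _ _ ↦ rfl, fun _ _ ↦ rfl⟩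
  add_mem' := fun ha hb h ↦
    ⟨fun x v ↦ congrArg₂ (· + ·) ((ha h).1 x v) ((hb h).1 x v),
      fun x v ↦ congrArg₂ (· + ·) ((ha h).2 x v) ((hb h).2 x v)⟩
  smul_mem' := fun c _ ha h ↦
    ⟨fun x v ↦ congrArg (c * ·) ((ha h).1 x v), fun x v ↦ congrArg (c * ·) ((ha h).2 x v)⟩

end OneForms

/-! ## The canonical connection of a Lie group -/

section Canonical

variable {E : Type*} [NormedAddCommGroup E] [NormedSpace ℝ E]
  {H : Type*} [TopologicalSpace H] {I : ModelWithCorners ℝ E H}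
  {G : Type*} [TopologicalSpace G] [ChartedSpace H G] [Group G]

/-- The left-invariant vector field on `G` whose value at `g` is `v`. -/
def leftExtension (g : G) (v : TangentSpace I g) (h : G) : TangentSpace I h :=
  mulInvariantVectorField (I := I) (mfderiv I I (fun x : G ↦ g⁻¹ * x) g v : E) h


lemma leftExtension_add (g : G) (v w : TangentSpace I g) :
    leftExtension g (v + w) = leftExtension g v + leftExtension g w := by
  funext h
  change mfderiv I I (fun x : G ↦ h * x) 1 (mfderiv I I (fun x : G ↦ g⁻¹ * x) g (v + w)) = _
  erw [map_add, map_add]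
  rfl

lemma leftExtension_smul (g : G) (c : ℝ) (v : TangentSpace I g) :
    leftExtension g (c • v) = c • leftExtension g v := by
  funext h
  change mfderiv I I (fun x : G ↦ h * x) 1 (mfderiv I I (fun x : G ↦ g⁻¹ * x) g (c • v)) = _
  erw [map_smul, map_smul]
  rfl

variable [LieGroup I ∞ G]

instance lieGroup_minSmoothness : LieGroup I (minSmoothness ℝ 3) G := by
  rw [minSmoothness_of_isRCLikeNormedField]; infer_instance

lemma leftExtension_mdifferentiableAt (g : G) (v : TangentSpace I g) (h : G) :
    MDiffAt (T% (leftExtension g v)) h :=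
  mdifferentiableAt_mulInvariantVectorField _

lemma leftExtension_mulInvariantVectorField (v : GroupLieAlgebra I G) (g : G) :
    leftExtension g (mulInvariantVectorField v g) = mulInvariantVectorField v := by
  funext h
  unfold leftExtension
  congr 1
  have D : ((fun x : G ↦ g⁻¹ * x) ∘ (fun x : G ↦ g * x)) = id := by ext x; simp
  have M : ∀ (a b : G), MDiffAt (fun x : G ↦ a * x) b := fun a b ↦
    (contMDiff_mul_left (I := I) (n := ∞)).contMDiffAt.mdifferentiableAt (by simp)
  have A : mfderiv I I ((fun x : G ↦ g⁻¹ * x) ∘ (fun x : G ↦ g * x)) 1 =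
      ContinuousLinearMap.id _ _ := by rw [D, id_eq, mfderiv_id]
  rw [mfderiv_comp (I' := I) _ (M _ _) (M _ _)] at A
  rw [mul_one] at A
  exact congrArg (fun L ↦ L v) A

/-- The left-invariant extension of `v` takes the value `v` at `g`. -/
lemma leftExtension_self (g : G) (v : TangentSpace I g) : leftExtension g v g = v := by
  have D : ((fun x : G ↦ g * x) ∘ (fun x : G ↦ g⁻¹ * x)) = id := by ext x; simp
  have M : ∀ (a b : G), MDiffAt (fun x : G ↦ a * x) b := fun a b ↦
    (contMDiff_mul_left (I := I) (n := ∞)).contMDiffAt.mdifferentiableAt (by simp)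
  have A : mfderiv I I ((fun x : G ↦ g * x) ∘ (fun x : G ↦ g⁻¹ * x)) g =
      ContinuousLinearMap.id _ _ := by rw [D, id_eq, mfderiv_id]
  rw [mfderiv_comp (I' := I) _ (M _ _) (M _ _), inv_mul_cancel] at A
  exact congrArg (fun L ↦ L v) A

variable [FiniteDimensional ℝ E]

variable (I G) in
/-- The canonical connection of the Lie group `G`: the connection with
`∇_X Y = (1 / 2) [X, Y]` on left-invariant vector fields, extended to arbitrary vector fields.
If `v` is a tangent vector at `g`, with left-invariant extension `X`, and `Z` is the left-invariant
vector field with `Z g = Y g`, then the Leibniz rule forces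
`∇_v Y = [X, Y] g - (1 / 2) [X, Z] g`, which is the formula below; its value on left-invariant
fields is `canonicalConnection_mulInvariantVectorField`. The argument order is
`canonicalConnection I G Y g v = ∇_v Y`. -/
def canonicalConnection : CovariantDerivative I E (TangentSpace I : G → Type _) where
  toFun Y g :=
    haveI : T2Space (TangentSpace I g) := inferInstanceAs (T2Space E)
    haveI : FiniteDimensional ℝ (TangentSpace I g) := inferInstanceAs (FiniteDimensional ℝ E)
    LinearMap.toContinuousLinearMap
    { toFun := fun v ↦ mlieBracket I (leftExtension g v) Y g -
        (1 / 2 : ℝ) • mlieBracket I (leftExtension g v) (leftExtension g (Y g)) g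
      map_add' := fun v w ↦ by
        rw [leftExtension_add, mlieBracket_add_left (leftExtension_mdifferentiableAt ..)
          (leftExtension_mdifferentiableAt ..), mlieBracket_add_left
          (leftExtension_mdifferentiableAt ..) (leftExtension_mdifferentiableAt ..)]
        module
      map_smul' := fun c v ↦ by
        rw [leftExtension_smul, mlieBracket_const_smul_left (leftExtension_mdifferentiableAt ..),
          mlieBracket_const_smul_left (leftExtension_mdifferentiableAt ..)]
        simp only [RingHom.id_apply]
        module }
  isCovariantDerivativeOnUniv := by
    constructor
    · intro Y Z g hY hZ _
      ext v
      change mlieBracket I (leftExtension g v) (Y + Z) g -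
          (1 / 2 : ℝ) • mlieBracket I (leftExtension g v) (leftExtension g (Y g + Z g)) g =
        (mlieBracket I (leftExtension g v) Y g -
          (1 / 2 : ℝ) • mlieBracket I (leftExtension g v) (leftExtension g (Y g)) g) +
        (mlieBracket I (leftExtension g v) Z g -
          (1 / 2 : ℝ) • mlieBracket I (leftExtension g v) (leftExtension g (Z g)) g)
      rw [mlieBracket_add_right hY hZ, leftExtension_add, mlieBracket_add_right
          (leftExtension_mdifferentiableAt ..) (leftExtension_mdifferentiableAt ..)]
      module
    · intro Y f g hY hf _
      ext v
      change mlieBracket I (leftExtension g v) (f • Y) g -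
          (1 / 2 : ℝ) • mlieBracket I (leftExtension g v) (leftExtension g (f g • Y g)) g =
        f g • (mlieBracket I (leftExtension g v) Y g -
          (1 / 2 : ℝ) • mlieBracket I (leftExtension g v) (leftExtension g (Y g)) g) +
        (d% f g v) • Y g
      rw [mlieBracket_smul_right hf hY, leftExtension_smul, mlieBracket_const_smul_right
          (leftExtension_mdifferentiableAt ..), leftExtension_self]
      module

/-- `∇_X Y = (1 / 2) [X, Y]` for left-invariant `X` and `Y`. -/
theorem canonicalConnection_mulInvariantVectorField (v w : GroupLieAlgebra I G) (g : G) :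
    canonicalConnection I G (mulInvariantVectorField w) g (mulInvariantVectorField v g) =
      (1 / 2 : ℝ) • mlieBracket I (mulInvariantVectorField v) (mulInvariantVectorField w) g := by
  change mlieBracket I (leftExtension g (mulInvariantVectorField v g)) _ g -
    (1 / 2 : ℝ) • mlieBracket I (leftExtension g (mulInvariantVectorField v g))
      (leftExtension g (mulInvariantVectorField w g)) g = _
  rw [leftExtension_mulInvariantVectorField, leftExtension_mulInvariantVectorField]
  module
end Canonical

/-! ## Flat connections, projection of connections, flat coordinates -/

section Connections

variable {E : Type*} [NormedAddCommGroup E] [NormedSpace ℝ E]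
  {H : Type*} [TopologicalSpace H] {I : ModelWithCorners ℝ E H}
  {M : Type*} [TopologicalSpace M] [ChartedSpace H M] [IsManifold I ∞ M]
  {E' : Type*} [NormedAddCommGroup E'] [NormedSpace ℝ E']
  {H' : Type*} [TopologicalSpace H'] {I' : ModelWithCorners ℝ E' H'}
  {N : Type*} [TopologicalSpace N] [ChartedSpace H' N] [IsManifold I' ∞ N]

/-- `X` is a smooth vector field on the whole of `M`. -/
def IsSmoothVectorField (X : Π x : M, TangentSpace I x) : Prop :=
  ContMDiff I I.tangent ∞ (fun x ↦ (X x : TangentBundle I M))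

/-- A connection on the tangent bundle is flat if its curvature
`R(X, Y) Z = ∇_X ∇_Y Z - ∇_Y ∇_X Z - ∇_[X, Y] Z` vanishes for all smooth vector fields. -/
def IsFlatConnection (cov : CovariantDerivative I E (TangentSpace I : M → Type _)) : Prop :=
  ∀ X Y Z : Π x : M, TangentSpace I x,
    IsSmoothVectorField X → IsSmoothVectorField Y → IsSmoothVectorField Z →
    ∀ x : M, cov (fun y ↦ cov Z y (Y y)) x (X x) - cov (fun y ↦ cov Z y (X y)) x (Y x)
      - cov Z x (mlieBracket I X Y x) = 0

/-- The vector fields `X` on `M` and `Y` on `N` are related by `f : M → N`. -/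
def AreRelated (f : M → N) (X : Π x : M, TangentSpace I x) (Y : Π y : N, TangentSpace I' y) :
    Prop :=
  ∀ x : M, mfderiv I I' f x (X x) = Y (f x)

/-- The connection `cov` on `M` projects along `f : M → N` to the connection `cov'` on `N`:
if `X`, `X'` and `Y`, `Y'` are pairs of `f`-related smooth vector fields, then `∇_X Y` and
`∇'_X' Y'` are `f`-related. -/
def ProjectsTo (f : M → N) (cov : CovariantDerivative I E (TangentSpace I : M → Type _))
    (cov' : CovariantDerivative I' E' (TangentSpace I' : N → Type _)) : Prop :=
  ∀ (X Y : Π x : M, TangentSpace I x) (X' Y' : Π y : N, TangentSpace I' y),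
    IsSmoothVectorField X → IsSmoothVectorField Y →
    IsSmoothVectorField X' → IsSmoothVectorField Y' →
    AreRelated f X X' → AreRelated f Y Y' →
    AreRelated f (fun x ↦ cov Y x (X x)) (fun y ↦ cov' Y' y (X' y))

/-- The one-forms `θ 0, …, θ (k - 1)` comprise a flat coordinate system for the connection `cov`:
around every point there is a smooth coordinate system `φ = (x_0, …, x_{k-1})` on an open set,
such that there `θ i = d x_i` and all Christoffel symbols vanish, that is,
`∇_v (∂ / ∂ x_i) = 0` for all `i` and all tangent vectors `v`. -/
def IsFlatCoordinateSystem (cov : CovariantDerivative I E (TangentSpace I : M → Type _))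
    {k : ℕ} (θ : Fin k → OneForm I M) : Prop :=
  ∀ p : M, ∃ φ : OpenPartialHomeomorph M (EuclideanSpace ℝ (Fin k)),
    p ∈ φ.source ∧
    ContMDiffOn I (𝓡 k) ∞ φ φ.source ∧
    ContMDiffOn (𝓡 k) I ∞ φ.symm φ.target ∧
    (∀ x ∈ φ.source, ∀ (i : Fin k) (v : TangentSpace I x),
      θ i x v = mfderiv I 𝓘(ℝ, ℝ) (fun y ↦ φ y i) x v) ∧
    (∀ x ∈ φ.source, ∀ (i : Fin k) (v : TangentSpace I x),
      cov (fun y ↦ mfderiv (𝓡 k) I φ.symm (φ y) (EuclideanSpace.single i (1 : ℝ))) x v = 0)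

end Connections

end

/-! Let `η` be the vector-valued form whose components are a basis of the bi-invariant one-forms. It
is closed: the symmetry `y ↦ g y⁻¹ g` reverses `η`, hence also `dη`, but its derivative at the fixed
point `g` is `-1`, which acts trivially on two-forms. So `η` has a primitive `f` near `1` with `f 1
= 0`. Bi-invariance makes `f` a local homomorphism, unchanged near `1` under conjugation by any
fixed element of `G`.

The crux is that, near `1`, the zero set of `f` is exactly `[G, G]`. Vanishing on `[G, G]`
(`eventually_eq_zero_of_mem_commutator`) is not automatic, since commutators close to `1` may
involve elements far from `1`. But modulo the subgroup generated by the graph of `f`, every element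
of `G × W` is a central element times a member of a countable subgroup, so commutators take only
countably many values and `f` has countable image on `[G, G]` near `1`
(`countable_image_commutator`). If `[G, G]` is closed, Baire's theorem makes `f` constant on an open
piece of it, and additivity carries this to `1`. Conversely
(`IsLocalPrimitive.eventually_mem_commutator`), the kernel of `η` at `1` is the span of the vectors
`Ad_g v - v`. These are velocities of curves of commutators `g p(t) g⁻¹ p(t)⁻¹`, on which `f`
vanishes. Products of such curves, multiplied by a slice transverse to the kernel, cover a
neighbourhood of `1`, and on these products `f` only sees the slice.

Hence `f` descends to a chart of `G / [G, G]` in which multiplication is addition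
(`exists_isLocallyAdditiveChart`). Its translates form an atlas whose transition maps are
translations. All tangent spaces become one vector space, componentwise differentiation is a flat
connection, and `dπ = η`. Bi-invariant forms become forms with constant coefficients. The canonical
connection projects because `η` kills brackets of left-invariant fields, which leaves `η (∇_X Y) = X
(η Y)`. -/

noncomputable section

/-! ### Derivatives of functions along Lie brackets. -/

section Bracket

variable {E : Type*} [NormedAddCommGroup E] [NormedSpace ℝ E]
  {M : Type*} [TopologicalSpace M] [ChartedSpace E M]
  {F : Type*} [NormedAddCommGroup F] [NormedSpace ℝ F]

/-- The second-derivative terms cancel by symmetry; only the derivatives of the fields survive. -/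
lemma fderiv_lieBracket {f : E → F} {X Y : E → E} {u : E} (hf : ContDiffAt ℝ 2 f u)
    (hX : DifferentiableAt ℝ X u) (hY : DifferentiableAt ℝ Y u) :
    fderiv ℝ f u (lieBracket ℝ X Y u) =
      fderiv ℝ (fun z ↦ fderiv ℝ f z (Y z)) u (X u) -
        fderiv ℝ (fun z ↦ fderiv ℝ f z (X z)) u (Y u) := by
  have hdf : DifferentiableAt ℝ (fderiv ℝ f) u :=
    (hf.fderiv_right (m := 1) (by norm_num)).differentiableAt (by norm_num)
  have hsymm : IsSymmSndFDerivAt ℝ f u := hf.isSymmSndFDerivAt (by simp)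
  rw [fderiv_clm_apply hdf hY, fderiv_clm_apply hdf hX]
  simp only [lieBracket_eq, add_apply, ContinuousLinearMap.comp_apply,
    ContinuousLinearMap.flip_apply, map_sub]
  rw [hsymm.eq (X u) (Y u)]
  abel

lemma mdifferentiableAt_extChartAt_symm_modelSelf [IsManifold 𝓘(ℝ, E) 1 M] {x : M} {u : E}
    (hu : u ∈ (extChartAt 𝓘(ℝ, E) x).target) :
    MDifferentiableAt 𝓘(ℝ, E) 𝓘(ℝ, E) (extChartAt 𝓘(ℝ, E) x).symm u := by
  have := mdifferentiableWithinAt_extChartAt_symm (I := 𝓘(ℝ, E)) hu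
  simpa only [modelWithCornersSelf_coe, Set.range_id, mdifferentiableWithinAt_univ] using this

lemma isInvertible_mfderiv_extChartAt_symm_modelSelf [IsManifold 𝓘(ℝ, E) 1 M] {x : M} {u : E}
    (hu : u ∈ (extChartAt 𝓘(ℝ, E) x).target) :
    (mfderiv 𝓘(ℝ, E) 𝓘(ℝ, E) (extChartAt 𝓘(ℝ, E) x).symm u).IsInvertible := by
  have := isInvertible_mfderivWithin_extChartAt_symm (I := 𝓘(ℝ, E)) hu
  simpa only [modelWithCornersSelf_coe, Set.range_id, mfderivWithin_univ] using this

lemma mfderiv_extChartAt_symm_modelSelf [IsManifold 𝓘(ℝ, E) 1 M] (x : M) :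
    mfderiv 𝓘(ℝ, E) 𝓘(ℝ, E) (extChartAt 𝓘(ℝ, E) x).symm (extChartAt 𝓘(ℝ, E) x x) =
      ContinuousLinearMap.id ℝ E := by
  have := mfderivWithin_range_extChartAt_symm (I := 𝓘(ℝ, E)) (x := x)
  simp only [modelWithCornersSelf_coe, Set.range_id, mfderivWithin_univ] at this
  exact this

variable [CompleteSpace E] [IsManifold 𝓘(ℝ, E) 2 M]

/-- The derivative of a vector-valued function along a Lie bracket of vector fields. -/
lemma mvfderiv_mlieBracket {f : M → F} {X Y : Π x : M, TangentSpace 𝓘(ℝ, E) x} {x : M}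
    (hf : ContMDiffAt 𝓘(ℝ, E) 𝓘(ℝ, F) 2 f x)
    (hX : MDifferentiableAt 𝓘(ℝ, E) 𝓘(ℝ, E).tangent (fun y ↦ (X y : TangentBundle 𝓘(ℝ, E) M)) x)
    (hY : MDifferentiableAt 𝓘(ℝ, E) 𝓘(ℝ, E).tangent (fun y ↦ (Y y : TangentBundle 𝓘(ℝ, E) M)) x) :
    mvfderiv 𝓘(ℝ, E) f x (mlieBracket 𝓘(ℝ, E) X Y x) =
      mvfderiv 𝓘(ℝ, E) (fun y ↦ mvfderiv 𝓘(ℝ, E) f y (Y y)) x (X x) -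
        mvfderiv 𝓘(ℝ, E) (fun y ↦ mvfderiv 𝓘(ℝ, E) f y (X y)) x (Y x) := by
  have : IsManifold 𝓘(ℝ, E) 1 M := .of_le (n := 2) (by norm_num)
  set c := extChartAt 𝓘(ℝ, E) x with hc
  set pull : (Π x : M, TangentSpace 𝓘(ℝ, E) x) → E → E := fun Z ↦
    mpullbackWithin 𝓘(ℝ, E) 𝓘(ℝ, E) c.symm Z Set.univ with hpull
  set g : E → F := f ∘ c.symm with hg
  have hcx : c.symm (c x) = x := extChartAt_to_inv x
  have hpd : ∀ Z : Π x : M, TangentSpace 𝓘(ℝ, E) x,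
      MDifferentiableAt 𝓘(ℝ, E) 𝓘(ℝ, E).tangent (fun y ↦ (Z y : TangentBundle 𝓘(ℝ, E) M)) x →
      DifferentiableAt ℝ (pull Z) (c x) := by
    intro Z hZ
    have := MDifferentiableWithinAt.differentiableWithinAt_mpullbackWithin_vectorField
      (s := Set.univ) hZ.mdifferentiableWithinAt
    refine differentiableWithinAt_univ.1 ?_
    simpa only [hpull, Set.preimage_univ, modelWithCornersSelf_coe, Set.range_id,
      Set.inter_univ] using this
  have htgt : c.target ∈ 𝓝 (c x) := extChartAt_target_mem_nhds x
  have hfx : ContMDiffAt 𝓘(ℝ, E) 𝓘(ℝ, F) 2 f (c.symm (c x)) := by rwa [hcx]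
  have hg2 : ContDiffAt ℝ 2 g (c x) := by
    rw [← contMDiffAt_iff_contDiffAt]
    exact hfx.comp _ ((contMDiffOn_extChartAt_symm x).contMDiffAt htgt)
  have hev : ∀ᶠ y in 𝓝 x, MDifferentiableAt 𝓘(ℝ, E) 𝓘(ℝ, F) f y ∧ y ∈ c.source := by
    have h1 : ∀ᶠ y in 𝓝 x, ContMDiffAt 𝓘(ℝ, E) 𝓘(ℝ, F) 2 f y :=
      (contMDiffAt_iff_contMDiffAt_nhds (by simp)).1 hf
    filter_upwards [h1, extChartAt_source_mem_nhds (I := 𝓘(ℝ, E)) x] with y hy hy'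
    exact ⟨hy.mdifferentiableAt (by norm_num), hy'⟩
  -- Differentiating `f` along `Z` is differentiating its coordinate expression `g` along the
  -- pulled-back field; this reduces the claim to the vector space `E`.
  have key : ∀ y, MDifferentiableAt 𝓘(ℝ, E) 𝓘(ℝ, F) f y → y ∈ c.source →
      ∀ Z : Π x : M, TangentSpace 𝓘(ℝ, E) x,
      mvfderiv 𝓘(ℝ, E) f y (Z y) = fderiv ℝ g (c y) (pull Z (c y)) := by
    intro y hfy hy Z
    have hyt := c.map_source hy
    have hcy : c.symm (c y) = y := c.left_inv hy
    have hs : MDifferentiableAt 𝓘(ℝ, E) 𝓘(ℝ, E) c.symm (c y) :=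
      mdifferentiableAt_extChartAt_symm_modelSelf hyt
    have hinv : (mfderiv 𝓘(ℝ, E) 𝓘(ℝ, E) c.symm (c y)).IsInvertible :=
      isInvertible_mfderiv_extChartAt_symm_modelSelf hyt
    have h2 : fderiv ℝ g (c y) = (mfderiv 𝓘(ℝ, E) 𝓘(ℝ, F) f (c.symm (c y))).comp
        (mfderiv 𝓘(ℝ, E) 𝓘(ℝ, E) c.symm (c y)) := by
      rw [← mfderiv_eq_fderiv]
      exact mfderiv_comp (c y) (by rwa [hcy]) hs
    have h3 : mfderiv 𝓘(ℝ, E) 𝓘(ℝ, E) c.symm (c y) (pull Z (c y)) = Z (c.symm (c y)) := by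
      simp only [hpull, mpullbackWithin_univ, mpullback_apply]
      exact hinv.self_apply_inverse _
    rw [h2]
    refine Eq.trans ?_ (congrArg (mfderiv 𝓘(ℝ, E) 𝓘(ℝ, F) f (c.symm (c y))) h3).symm
    rw [hcy]
    rfl
  have hfd : MDifferentiableAt 𝓘(ℝ, E) 𝓘(ℝ, F) f x := hf.mdifferentiableAt (by norm_num)
  have hder : ∀ Z Z' : Π x : M, TangentSpace 𝓘(ℝ, E) x,
      MDifferentiableAt 𝓘(ℝ, E) 𝓘(ℝ, E).tangent (fun y ↦ (Z y : TangentBundle 𝓘(ℝ, E) M)) x →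
      mvfderiv 𝓘(ℝ, E) (fun y ↦ mvfderiv 𝓘(ℝ, E) f y (Z y)) x (Z' x) =
        fderiv ℝ (fun u ↦ fderiv ℝ g u (pull Z u)) (c x) (pull Z' (c x)) := by
    intro Z Z' hZ
    have h1 : (fun y ↦ mvfderiv 𝓘(ℝ, E) f y (Z y)) =ᶠ[𝓝 x]
        (fun u ↦ fderiv ℝ g u (pull Z u)) ∘ c := by
      filter_upwards [hev] with y hy
      exact key y hy.1 hy.2 Z
    have hdiff : DifferentiableAt ℝ (fun u ↦ fderiv ℝ g u (pull Z u)) (c x) :=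
      ((hg2.fderiv_right (m := 1) (by norm_num)).differentiableAt (by norm_num)).clm_apply
        (hpd Z hZ)
    change mfderiv 𝓘(ℝ, E) 𝓘(ℝ, F) (fun y ↦ mvfderiv 𝓘(ℝ, E) f y (Z y)) x (Z' x) = _
    rw [h1.mfderiv_eq, mfderiv_comp x hdiff.mdifferentiableAt
      (mdifferentiableAt_extChartAt (mem_chart_source _ x)), mfderiv_eq_fderiv]
    -- The tangent space at `x` is read in the preferred chart at `x`, so at the centre the chart
    -- and its inverse have derivative `1`.
    have h4 : pull Z' (c x) = Z' x := by
      have h6 : mfderiv 𝓘(ℝ, E) 𝓘(ℝ, E) c.symm (c x) = ContinuousLinearMap.id ℝ E :=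
        mfderiv_extChartAt_symm_modelSelf x
      simp only [hpull, mpullbackWithin_univ, mpullback_apply]
      rw [h6]
      erw [ContinuousLinearMap.inverse_id]
      rw [hcx]
      rfl
    rw [h4]
    have h7 : mfderiv 𝓘(ℝ, E) 𝓘(ℝ, E) c x = ContinuousLinearMap.id ℝ E := mfderiv_extChartAt_self
    rw [h7]
    rfl
  rw [hder Y X hY, hder X Y hX, ← fderiv_lieBracket hg2 (hpd X hX) (hpd Y hY)]
  rw [← mlieBracketWithin_univ, mlieBracketWithin_apply]
  have h7 : mfderiv 𝓘(ℝ, E) 𝓘(ℝ, E) c x = ContinuousLinearMap.id ℝ E := mfderiv_extChartAt_self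
  rw [← hc, h7]
  have h8 : mfderiv 𝓘(ℝ, E) 𝓘(ℝ, F) f x = fderiv ℝ g (c x) := by
    have h6 : mfderiv 𝓘(ℝ, E) 𝓘(ℝ, E) c.symm (c x) = ContinuousLinearMap.id ℝ E :=
      mfderiv_extChartAt_symm_modelSelf x
    have hs : MDifferentiableAt 𝓘(ℝ, E) 𝓘(ℝ, E) c.symm (c x) :=
      mdifferentiableAt_extChartAt_symm_modelSelf (mem_extChartAt_target x)
    rw [← mfderiv_eq_fderiv, hg, mfderiv_comp (c x) (by rwa [hcx]) hs, h6, hcx]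
    rfl
  erw [ContinuousLinearMap.inverse_id]
  change mfderiv 𝓘(ℝ, E) 𝓘(ℝ, F) f x (lieBracketWithin ℝ _ _ _ _ : E) = _
  rw [h8]
  simp only [hpull, Set.preimage_univ, modelWithCornersSelf_coe, Set.range_id, Set.inter_univ]
  exact congrArg _ (congrFun lieBracketWithin_univ _)

end Bracket

/-! ### Manifolds whose transition maps are translations, and their flat connection. -/

section TranslationAtlas

variable {W : Type*} [NormedAddCommGroup W]
  {M : Type*} [TopologicalSpace M] [ChartedSpace W M]

variable (W M) in
/-- The transition maps of the atlas of `M` are locally translations. -/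
class HasTranslationAtlas : Prop where
  eventually_eq : ∀ e ∈ atlas W M, ∀ e' ∈ atlas W M, ∀ x ∈ e.source, x ∈ e'.source →
    ∀ᶠ y in 𝓝 x, e' y = e y + (e' x - e x)

variable [HasTranslationAtlas W M]

lemma HasTranslationAtlas.eventually_comp_symm {e e' : OpenPartialHomeomorph M W}
    (he : e ∈ atlas W M) (he' : e' ∈ atlas W M) {x : M} (hx : x ∈ e.source) (hx' : x ∈ e'.source) :
    ∀ᶠ u in 𝓝 (e x), e' (e.symm u) = u + (e' x - e x) := by
  have h := HasTranslationAtlas.eventually_eq e he e' he' x hx hx'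
  have h2 : Filter.Tendsto e.symm (𝓝 (e x)) (𝓝 x) := by
    have := e.continuousAt_symm (e.map_source hx)
    rwa [ContinuousAt, e.left_inv hx] at this
  filter_upwards [h2.eventually h, e.open_target.mem_nhds (e.map_source hx)] with u hu hut
  rw [hu, e.right_inv hut]

instance : HasTranslationAtlas W W where
  eventually_eq e he e' he' x _ _ := by
    rw [chartedSpaceSelf_atlas] at he he'
    subst he he'
    simp

variable [NormedSpace ℝ W]

variable (W M) in
lemma HasTranslationAtlas.isManifold (n : ℕ∞ω) : IsManifold 𝓘(ℝ, W) n M := by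
  refine isManifold_of_contDiffOn _ _ _ fun e e' he he' ↦ ?_
  rintro u ⟨hu, -⟩
  simp only [modelWithCornersSelf_coe_symm, Set.preimage_id_eq, id_eq,
    OpenPartialHomeomorph.trans_source, OpenPartialHomeomorph.symm_source, Set.mem_inter_iff,
    Set.mem_preimage] at hu
  refine ContDiffAt.contDiffWithinAt ?_
  have h := HasTranslationAtlas.eventually_comp_symm he he' (e.map_target hu.1) hu.2
  rw [e.right_inv hu.1] at h
  refine ContDiffAt.congr_of_eventuallyEq (f := fun v ↦ v + (e' (e.symm u) - u)) ?_ ?_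
  · exact contDiffAt_id.add contDiffAt_const
  · filter_upwards [h] with v hv
    simpa using hv

variable [IsManifold 𝓘(ℝ, W) 1 M]

/-- Near `x` the chart at `x₀` is the preferred chart at `x` followed by a translation. Thus the
identification of tangent spaces with `W` does not depend on the chart, and vector fields and forms
may be treated as functions with values in a fixed space. -/
lemma HasTranslationAtlas.mfderiv_extChartAt {x₀ x : M} (hx : x ∈ (chartAt W x₀).source) :
    mfderiv 𝓘(ℝ, W) 𝓘(ℝ, W) (extChartAt 𝓘(ℝ, W) x₀) x = ContinuousLinearMap.id ℝ W := by
  have h := HasTranslationAtlas.eventually_eq (chartAt W x) (chart_mem_atlas W x) (chartAt W x₀)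
    (chart_mem_atlas W x₀) x (mem_chart_source W x) hx
  have h1 : (extChartAt 𝓘(ℝ, W) x₀ : M → W) =ᶠ[𝓝 x]
      (fun u ↦ u + (chartAt W x₀ x - chartAt W x x)) ∘ (extChartAt 𝓘(ℝ, W) x) := by
    filter_upwards [h] with y hy
    simpa using hy
  have hid : HasFDerivAt (fun u : W ↦ u + (chartAt W x₀ x - chartAt W x x))
      (ContinuousLinearMap.id ℝ W) (extChartAt 𝓘(ℝ, W) x x) := (hasFDerivAt_id _).add_const _
  have h2 := hid.hasMFDerivAt.comp x
    (mdifferentiableAt_extChartAt (I := 𝓘(ℝ, W)) (mem_chart_source W x)).hasMFDerivAt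
  rw [h1.mfderiv_eq, h2.mfderiv]
  erw [mfderiv_extChartAt_self]
  rfl

lemma HasTranslationAtlas.continuousLinearMapAt_trivializationAt {x₀ x : M}
    (hx : x ∈ (chartAt W x₀).source) :
    (trivializationAt W (TangentSpace 𝓘(ℝ, W)) x₀).continuousLinearMapAt ℝ x =
      ContinuousLinearMap.id ℝ W :=
  (TangentBundle.continuousLinearMapAt_trivializationAt hx).trans
    (HasTranslationAtlas.mfderiv_extChartAt hx)

lemma HasTranslationAtlas.symmL_trivializationAt {x₀ x : M} (hx : x ∈ (chartAt W x₀).source) :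
    (trivializationAt W (TangentSpace 𝓘(ℝ, W)) x₀).symmL ℝ x = ContinuousLinearMap.id ℝ W := by
  have hx' : x ∈ (trivializationAt W (TangentSpace 𝓘(ℝ, W) : M → Type _) x₀).baseSet := by
    simpa using hx
  ext v
  have h := (trivializationAt W (TangentSpace 𝓘(ℝ, W) : M → Type _) x₀).continuousLinearMapAt_symmL
    (R := ℝ) hx' v
  erw [HasTranslationAtlas.continuousLinearMapAt_trivializationAt hx] at h
  exact h

lemma HasTranslationAtlas.trivializationAt_apply {x₀ x : M} (hx : x ∈ (chartAt W x₀).source)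
    (v : TangentSpace 𝓘(ℝ, W) x) :
    (trivializationAt W (TangentSpace 𝓘(ℝ, W)) x₀ ⟨x, v⟩).2 = v := by
  have hx' : x ∈ (trivializationAt W (TangentSpace 𝓘(ℝ, W) : M → Type _) x₀).baseSet := by
    simpa using hx
  have h := congrArg (fun L : W →L[ℝ] W ↦ L v)
    (HasTranslationAtlas.continuousLinearMapAt_trivializationAt hx)
  have h2 := congrFun (Trivialization.coe_linearMapAt_of_mem (R := ℝ)
    (trivializationAt W (TangentSpace 𝓘(ℝ, W)) x₀) hx') v
  exact h2.symm.trans h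

lemma contMDiffAt_vectorField_iff {n : ℕ∞ω} {X : Π x : M, TangentSpace 𝓘(ℝ, W) x} {x : M} :
    ContMDiffAt 𝓘(ℝ, W) 𝓘(ℝ, W).tangent n (fun y ↦ (X y : TangentBundle 𝓘(ℝ, W) M)) x ↔
      ContMDiffAt 𝓘(ℝ, W) 𝓘(ℝ, W) n (fun y ↦ (X y : W)) x := by
  refine (contMDiffAt_section (IB := 𝓘(ℝ, W)) (s := X) x).trans
    (Filter.EventuallyEq.contMDiffAt_iff ?_)
  filter_upwards [(chartAt W x).open_source.mem_nhds (mem_chart_source W x)] with y hy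
  exact HasTranslationAtlas.trivializationAt_apply hy _

lemma mdifferentiableAt_vectorField_iff {X : Π x : M, TangentSpace 𝓘(ℝ, W) x} {x : M} :
    MDifferentiableAt 𝓘(ℝ, W) 𝓘(ℝ, W).tangent (fun y ↦ (X y : TangentBundle 𝓘(ℝ, W) M)) x ↔
      MDifferentiableAt 𝓘(ℝ, W) 𝓘(ℝ, W) (fun y ↦ (X y : W)) x := by
  refine (mdifferentiableAt_section 𝓘(ℝ, W) X).trans
    (Filter.EventuallyEq.mdifferentiableAt_iff ?_)
  filter_upwards [(chartAt W x).open_source.mem_nhds (mem_chart_source W x)] with y hy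
  exact HasTranslationAtlas.trivializationAt_apply hy _

/-- A smooth function with values in endomorphisms of `W` is a smooth section of `Hom(TM, TM)`. -/
lemma contMDiffAt_endomorphism_section {n : ℕ∞ω} {A : M → W →L[ℝ] W} {x : M}
    (hA : ContMDiffAt 𝓘(ℝ, W) 𝓘(ℝ, W →L[ℝ] W) n A x) :
    ContMDiffAt 𝓘(ℝ, W) (𝓘(ℝ, W).prod 𝓘(ℝ, W →L[ℝ] W)) n
      (fun y ↦ (⟨y, A y⟩ : TotalSpace (W →L[ℝ] W)
        fun y : M ↦ TangentSpace 𝓘(ℝ, W) y →L[ℝ] TangentSpace 𝓘(ℝ, W) y)) x := by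
  rw [contMDiffAt_hom_bundle]
  refine ⟨contMDiffAt_id, hA.congr_of_eventuallyEq ?_⟩
  filter_upwards [(chartAt W x).open_source.mem_nhds (mem_chart_source W x)] with y hy
  simp only [ContinuousLinearMap.inCoordinates]
  rw [HasTranslationAtlas.continuousLinearMapAt_trivializationAt hy,
    HasTranslationAtlas.symmL_trivializationAt hy]
  rfl

/-- A smooth function with values in the dual of `W` is a smooth one-form. -/
lemma contMDiffAt_dual_section {n : ℕ∞ω} {A : M → W →L[ℝ] ℝ} {x : M}
    (hA : ContMDiffAt 𝓘(ℝ, W) 𝓘(ℝ, W →L[ℝ] ℝ) n A x) :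
    ContMDiffAt 𝓘(ℝ, W) (𝓘(ℝ, W).prod 𝓘(ℝ, W →L[ℝ] ℝ)) n
      (fun y ↦ (⟨y, A y⟩ : TotalSpace (W →L[ℝ] ℝ)
        fun y : M ↦ TangentSpace 𝓘(ℝ, W) y →L[ℝ] Trivial M ℝ y)) x := by
  rw [contMDiffAt_hom_bundle]
  refine ⟨contMDiffAt_id, hA.congr_of_eventuallyEq ?_⟩
  filter_upwards [(chartAt W x).open_source.mem_nhds (mem_chart_source W x)] with y hy
  simp only [ContinuousLinearMap.inCoordinates]
  rw [HasTranslationAtlas.symmL_trivializationAt hy]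
  ext v
  simp
  rfl

lemma contMDiffAt_mvfderiv {m n : ℕ∞ω} (hmn : m + 1 ≤ n) [IsManifold 𝓘(ℝ, W) n M] {f : M → W} {x : M}
    (hf : ContMDiffAt 𝓘(ℝ, W) 𝓘(ℝ, W) n f x) :
    ContMDiffAt 𝓘(ℝ, W) 𝓘(ℝ, W →L[ℝ] W) m (M' := W →L[ℝ] W)
      (fun y ↦ mvfderiv 𝓘(ℝ, W) f y) x := by
  refine (hf.mfderiv_const hmn).congr_of_eventuallyEq ?_
  filter_upwards [(chartAt W x).open_source.mem_nhds (mem_chart_source W x)] with y hy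
  simp only [inTangentCoordinates, ContinuousLinearMap.inCoordinates]
  rw [HasTranslationAtlas.continuousLinearMapAt_trivializationAt (M := W) (x₀ := f x) (x := f y)
      (by rw [chartAt_self_eq]; trivial),
    HasTranslationAtlas.symmL_trivializationAt (x₀ := id x) (x := id y) hy]
  rfl

variable (W M) in
/-- The flat connection of a manifold whose transition maps are translations: differentiation of
the components of vector fields. -/
def translationConnection :
    CovariantDerivative 𝓘(ℝ, W) W (TangentSpace 𝓘(ℝ, W) : M → Type _) where
  toFun Y x := (mvfderiv 𝓘(ℝ, W) (fun y ↦ (Y y : W)) x : TangentSpace 𝓘(ℝ, W) x →L[ℝ] W)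
  isCovariantDerivativeOnUniv := by
    constructor
    · intro Y Z x hY hZ _
      rw [mdifferentiableAt_vectorField_iff] at hY hZ
      exact mvfderiv_add hY hZ
    · intro Y f x hY hf _
      rw [mdifferentiableAt_vectorField_iff] at hY
      exact mvfderiv_smul hf hY

lemma contMDiffCovariantDerivative_translationConnection [IsManifold 𝓘(ℝ, W) ∞ M] :
    (translationConnection W M).ContMDiffCovariantDerivative ∞ where
  contMDiff := ⟨by
    intro Y hY x _
    have hY' : ContMDiffAt 𝓘(ℝ, W) 𝓘(ℝ, W) ∞ (fun y ↦ (Y y : W)) x :=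
      contMDiffAt_vectorField_iff.1 (hY.contMDiffAt Filter.univ_mem)
    exact (contMDiffAt_endomorphism_section
      (contMDiffAt_mvfderiv (m := ∞) (n := ∞) le_rfl hY')).contMDiffWithinAt⟩

/-- With `Z` viewed as a `W`-valued function, vanishing of the curvature is the formula for its
derivative along `[X, Y]`. -/
lemma isFlatConnection_translationConnection [CompleteSpace W] [IsManifold 𝓘(ℝ, W) ∞ M] :
    IsFlatConnection (translationConnection W M) := by
  intro X Y Z hX hY hZ x
  have : IsManifold 𝓘(ℝ, W) 2 M := .of_le (n := ∞) (by norm_cast)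
  have hZ' : ContMDiffAt 𝓘(ℝ, W) 𝓘(ℝ, W) ∞ (fun y ↦ (Z y : W)) x :=
    contMDiffAt_vectorField_iff.1 (hZ x)
  have h := mvfderiv_mlieBracket (hZ'.of_le (by norm_cast))
    ((hX x).mdifferentiableAt (by simp)) ((hY x).mdifferentiableAt (by simp))
  exact sub_eq_zero.2 h.symm

end TranslationAtlas

/-! ### Flat coordinates from constant-coefficient coframes. -/

section FlatCoordinates

variable {W : Type*} [NormedAddCommGroup W] [NormedSpace ℝ W]
  {M : Type*} [TopologicalSpace M] [ChartedSpace W M] [HasTranslationAtlas W M]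
  [IsManifold 𝓘(ℝ, W) 1 M]

lemma HasTranslationAtlas.mfderiv_extChartAt_symm {x₀ x : M} (hx : x ∈ (chartAt W x₀).source) :
    mfderiv 𝓘(ℝ, W) 𝓘(ℝ, W) (extChartAt 𝓘(ℝ, W) x₀).symm (extChartAt 𝓘(ℝ, W) x₀ x) =
      ContinuousLinearMap.id ℝ W := by
  have h := TangentBundle.symmL_trivializationAt (I := 𝓘(ℝ, W)) hx
  rw [HasTranslationAtlas.symmL_trivializationAt hx] at h
  simp only [modelWithCornersSelf_coe, Set.range_id, mfderivWithin_univ] at h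
  exact h.symm

variable [IsManifold 𝓘(ℝ, W) ∞ M]

/-- On a manifold whose transition maps are translations, one-forms with constant coefficients
comprise a flat coordinate system as soon as they are a coframe. -/
lemma isFlatCoordinateSystem_translationConnection {k : ℕ} (L : W ≃L[ℝ] EuclideanSpace ℝ (Fin k))
    (θ : Fin k → OneForm 𝓘(ℝ, W) M)
    (hθ : ∀ (i : Fin k) (x : M) (v : TangentSpace 𝓘(ℝ, W) x), θ i x v = L (v : W) i) :
    IsFlatCoordinateSystem (translationConnection W M) θ := by
  intro p
  set c := extChartAt 𝓘(ℝ, W) p with hc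
  set φ : OpenPartialHomeomorph M (EuclideanSpace ℝ (Fin k)) :=
    (chartAt W p).transHomeomorph L.toHomeomorph with hφ
  have hφs : φ.source = (chartAt W p).source := rfl
  have hφe : (φ : M → EuclideanSpace ℝ (Fin k)) = L ∘ c := rfl
  have hφse : (φ.symm : EuclideanSpace ℝ (Fin k) → M) = c.symm ∘ L.symm := rfl
  have hφt : φ.target = L.symm ⁻¹' c.target := by simp [hφ, hc]
  have hcd : ∀ x ∈ φ.source, MDifferentiableAt 𝓘(ℝ, W) 𝓘(ℝ, W) c x := fun x hx ↦
    mdifferentiableAt_extChartAt hx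
  -- The coordinate fields have constant components, so their covariant derivatives vanish.
  have hpart : ∀ x ∈ φ.source, ∀ i : Fin k,
      mfderiv (𝓡 k) 𝓘(ℝ, W) φ.symm (φ x) (EuclideanSpace.single i (1 : ℝ)) =
        L.symm (EuclideanSpace.single i (1 : ℝ)) := by
    intro x hx i
    have h1 : L.symm (φ x) = c x := by simp [hφe]
    have h2 : MDifferentiableAt 𝓘(ℝ, W) 𝓘(ℝ, W) c.symm (L.symm (φ x)) := by
      rw [h1]
      exact mdifferentiableAt_extChartAt_symm_modelSelf (c.map_source (by simpa [hc, hφs] using hx))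
    rw [hφse, mfderiv_comp (φ x) h2 L.symm.differentiableAt.mdifferentiableAt, mfderiv_eq_fderiv,
      L.symm.fderiv]
    have h3 : mfderiv 𝓘(ℝ, W) 𝓘(ℝ, W) c.symm (L.symm (φ x)) = ContinuousLinearMap.id ℝ W := by
      rw [h1]
      exact HasTranslationAtlas.mfderiv_extChartAt_symm hx
    rw [h3]
    rfl
  refine ⟨φ, mem_chart_source W p, ?_, ?_, ?_, ?_⟩
  · rw [hφe, hφs]
    exact L.contDiff.contMDiff.comp_contMDiffOn contMDiffOn_extChartAt
  · rw [hφse, hφt]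
    exact (contMDiffOn_extChartAt_symm p).comp L.symm.contDiff.contMDiff.contMDiffOn
      (fun _ h ↦ h)
  · intro x hx i v
    rw [hθ]
    have h1 : (fun y ↦ φ y i) = (fun w ↦ L w i) ∘ c := rfl
    have h2 : HasFDerivAt (fun w ↦ L w i)
        ((EuclideanSpace.proj (𝕜 := ℝ) i).comp (L : W →L[ℝ] EuclideanSpace ℝ (Fin k))) (c x) :=
      ((EuclideanSpace.proj (𝕜 := ℝ) i).comp (L : W →L[ℝ] EuclideanSpace ℝ (Fin k))).hasFDerivAt
    rw [h1, (h2.hasMFDerivAt.comp x (hcd x hx).hasMFDerivAt).mfderiv]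
    have h3 : mfderiv 𝓘(ℝ, W) 𝓘(ℝ, W) c x = ContinuousLinearMap.id ℝ W :=
      HasTranslationAtlas.mfderiv_extChartAt hx
    rw [h3]
    rfl
  · intro x hx i v
    have h1 : (fun y ↦ (mfderiv (𝓡 k) 𝓘(ℝ, W) φ.symm (φ y) (EuclideanSpace.single i (1 : ℝ)) : W))
        =ᶠ[𝓝 x] fun _ ↦ L.symm (EuclideanSpace.single i (1 : ℝ)) := by
      filter_upwards [φ.open_source.mem_nhds hx] with y hy
      exact hpart y hy i
    have h2 : mfderiv 𝓘(ℝ, W) 𝓘(ℝ, W) (fun y ↦ (mfderiv (𝓡 k) 𝓘(ℝ, W) φ.symm (φ y)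
        (EuclideanSpace.single i (1 : ℝ)) : W)) x = 0 := by
      rw [h1.mfderiv_eq]
      exact mfderiv_const
    exact congrArg (fun A : W →L[ℝ] W ↦ A v) h2

end FlatCoordinates

/-! ### Bi-invariant forms and geodesic symmetries. -/

section BiInvariant

variable {E : Type*} [NormedAddCommGroup E] [NormedSpace ℝ E]
  {G : Type*} [TopologicalSpace G] [ChartedSpace E G]
  {W : Type*} [NormedAddCommGroup W] [NormedSpace ℝ W]

section

variable {F : Type*} [NormedAddCommGroup F] [NormedSpace ℝ F]
  {H : Type*} [TopologicalSpace H] {J : ModelWithCorners ℝ F H}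
  {M : Type*} [TopologicalSpace M] [ChartedSpace H M]

/-- Constancy is a pointwise hypothesis so that the base point `r z`, on which the tangent space
depends, never has to be rewritten. -/
lemma apply_mfderiv_eq_zero_of_const (η : Π x : G, TangentSpace 𝓘(ℝ, E) x →L[ℝ] W)
    {r : M → G} {g : G} (hr : ∀ y, r y = g) (z : M) (v : TangentSpace J z) :
    η (r z) (mfderiv J 𝓘(ℝ, E) r z v) = 0 := by
  obtain rfl : r = fun _ ↦ g := funext hr
  rw [mfderiv_const]
  exact map_zero (η g)
end

variable [Group G]

/-- A family of linear maps `T_x G → W` invariant under left and right translations. -/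
structure IsBiInvariantForm (η : Π x : G, TangentSpace 𝓘(ℝ, E) x →L[ℝ] W) : Prop where
  left (h x : G) (v : TangentSpace 𝓘(ℝ, E) x) :
    η (h * x) (mfderiv 𝓘(ℝ, E) 𝓘(ℝ, E) (fun y ↦ h * y) x v) = η x v
  right (h x : G) (v : TangentSpace 𝓘(ℝ, E) x) :
    η (x * h) (mfderiv 𝓘(ℝ, E) 𝓘(ℝ, E) (fun y ↦ y * h) x v) = η x v

variable [LieGroup 𝓘(ℝ, E) ∞ G]

section

variable {F : Type*} [NormedAddCommGroup F] [NormedSpace ℝ F]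
  {H : Type*} [TopologicalSpace H] {J : ModelWithCorners ℝ F H}
  {M : Type*} [TopologicalSpace M] [ChartedSpace H M]

lemma MDifferentiableAt.groupMul {p q : M → G} {z : M} (hp : MDifferentiableAt J 𝓘(ℝ, E) p z)
    (hq : MDifferentiableAt J 𝓘(ℝ, E) q z) :
    MDifferentiableAt J 𝓘(ℝ, E) (fun z ↦ p z * q z) z :=
  ((contMDiff_mul 𝓘(ℝ, E) ∞ (G := G)).mdifferentiable (by simp) (p z, q z)).comp z
    (hp.prodMk hq)

lemma MDifferentiableAt.groupInv {p : M → G} {z : M} (hp : MDifferentiableAt J 𝓘(ℝ, E) p z) :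
    MDifferentiableAt J 𝓘(ℝ, E) (fun z ↦ (p z)⁻¹) z :=
  ((contMDiff_inv 𝓘(ℝ, E) ∞ (G := G)).mdifferentiable (by simp) (p z)).comp z hp

lemma mfderiv_groupMul {p q : M → G} {z : M} (hp : MDifferentiableAt J 𝓘(ℝ, E) p z)
    (hq : MDifferentiableAt J 𝓘(ℝ, E) q z) (v : TangentSpace J z) :
    mfderiv J 𝓘(ℝ, E) (fun z ↦ p z * q z) z v =
      (mfderiv 𝓘(ℝ, E) 𝓘(ℝ, E) (fun x ↦ x * q z) (p z) (mfderiv J 𝓘(ℝ, E) p z v) +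
        mfderiv 𝓘(ℝ, E) 𝓘(ℝ, E) (fun x ↦ p z * x) (q z) (mfderiv J 𝓘(ℝ, E) q z v) : E) := by
  have hm : MDifferentiableAt (𝓘(ℝ, E).prod 𝓘(ℝ, E)) 𝓘(ℝ, E) (fun x : G × G ↦ x.1 * x.2)
    (p z, q z) := (contMDiff_mul 𝓘(ℝ, E) ∞ (G := G)).mdifferentiable (by simp) (p z, q z)
  have h1 : (fun z ↦ p z * q z) = (fun x : G × G ↦ x.1 * x.2) ∘ (fun z ↦ (p z, q z)) := rfl
  have h2 := mfderiv_comp z hm (hp.prodMk hq)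
  rw [h1, h2]
  have h3 := hp.mfderiv_prod hq
  rw [h3]
  exact mfderiv_prod_eq_add_apply hm

variable {η : Π x : G, TangentSpace 𝓘(ℝ, E) x →L[ℝ] W}

/-- The product rule translates one velocity on the right and the other on the left, and `η` ignores
both translations. -/
lemma IsBiInvariantForm.mfderiv_mul (hη : IsBiInvariantForm η) {p q : M → G} {z : M}
    (hp : MDifferentiableAt J 𝓘(ℝ, E) p z)
    (hq : MDifferentiableAt J 𝓘(ℝ, E) q z) (v : TangentSpace J z) :
    η (p z * q z) (mfderiv J 𝓘(ℝ, E) (fun z ↦ p z * q z) z v) =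
      η (p z) (mfderiv J 𝓘(ℝ, E) p z v) + η (q z) (mfderiv J 𝓘(ℝ, E) q z v) := by
  rw [mfderiv_groupMul hp hq, ← hη.right (q z) (p z), ← hη.left (p z) (q z)]
  exact map_add (η (p z * q z)) _ _

lemma IsBiInvariantForm.mfderiv_inv (hη : IsBiInvariantForm η) {p : M → G} {z : M}
    (hp : MDifferentiableAt J 𝓘(ℝ, E) p z) (v : TangentSpace J z) :
    η (p z)⁻¹ (mfderiv J 𝓘(ℝ, E) (fun z ↦ (p z)⁻¹) z v) = -η (p z) (mfderiv J 𝓘(ℝ, E) p z v) := by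
  have h := hη.mfderiv_mul hp hp.groupInv v
  rw [apply_mfderiv_eq_zero_of_const η (r := fun z ↦ p z * (p z)⁻¹) (g := 1) (by simp)] at h
  exact (neg_eq_of_add_eq_zero_right h.symm).symm

end

/-- The geodesic symmetry `x ↦ g x⁻¹ g` reverses bi-invariant forms. -/
lemma IsBiInvariantForm.mfderiv_symmetry {η : Π x : G, TangentSpace 𝓘(ℝ, E) x →L[ℝ] W}
    (hη : IsBiInvariantForm η) (g x : G) (v : TangentSpace 𝓘(ℝ, E) x) :
    η (g * x⁻¹ * g) (mfderiv 𝓘(ℝ, E) 𝓘(ℝ, E) (fun y : G ↦ g * y⁻¹ * g) x v) = -η x v := by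
  have hid : MDifferentiableAt 𝓘(ℝ, E) 𝓘(ℝ, E) (fun y : G ↦ y) x := mdifferentiableAt_id
  have hc : MDifferentiableAt 𝓘(ℝ, E) 𝓘(ℝ, E) (fun _ : G ↦ g) x := mdifferentiableAt_const
  rw [hη.mfderiv_mul (hc.groupMul hid.groupInv) hc v, hη.mfderiv_mul hc hid.groupInv v,
    hη.mfderiv_inv hid v, apply_mfderiv_eq_zero_of_const η (r := fun _ ↦ g) (fun _ ↦ rfl)]
  have : mfderiv 𝓘(ℝ, E) 𝓘(ℝ, E) (fun y : G ↦ y) x = ContinuousLinearMap.id ℝ _ := mfderiv_id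
  rw [this]
  simp

/-- The geodesic symmetry at `g` has derivative `-1` at `g`. -/
lemma mfderiv_symmetry_self (g : G) :
    mfderiv 𝓘(ℝ, E) 𝓘(ℝ, E) (fun y : G ↦ g * y⁻¹ * g) g = -ContinuousLinearMap.id ℝ E := by
  have hid : MDifferentiableAt 𝓘(ℝ, E) 𝓘(ℝ, E) (fun y : G ↦ y) g := mdifferentiableAt_id
  have hc : ∀ h : G, MDifferentiableAt 𝓘(ℝ, E) 𝓘(ℝ, E) (fun _ : G ↦ h) g := fun h ↦
    mdifferentiableAt_const
  have hs := ((hc g).groupMul hid.groupInv).groupMul (hc g)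
  have hp : MDifferentiableAt 𝓘(ℝ, E) 𝓘(ℝ, E) (fun y : G ↦ y * g⁻¹) g := hid.groupMul (hc g⁻¹)
  have hid' : mfderiv 𝓘(ℝ, E) 𝓘(ℝ, E) (fun y : G ↦ y) g = ContinuousLinearMap.id ℝ _ := mfderiv_id
  ext v
  -- The product `(y g⁻¹) (g y⁻¹ g)` is constantly `g`. Its zero derivative is the sum of `v` and
  -- the derivative of the symmetry.
  have h := mfderiv_groupMul hp hs v
  have e1 : ∀ (r : G → G), (∀ y, r y = g) → (mfderiv 𝓘(ℝ, E) 𝓘(ℝ, E) r g v : E) = 0 := by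
    intro r hr
    obtain rfl : r = fun _ ↦ g := funext hr
    rw [mfderiv_const]
    rfl
  have e2 : ∀ (r : G → G), (∀ y, r y = y) → ∀ (y : G) (w : E),
      (mfderiv 𝓘(ℝ, E) 𝓘(ℝ, E) r y w : E) = w := by
    intro r hr y w
    obtain rfl : r = fun y ↦ y := funext hr
    have : mfderiv 𝓘(ℝ, E) 𝓘(ℝ, E) (fun x : G ↦ x) y = ContinuousLinearMap.id ℝ _ := mfderiv_id
    rw [this]; rfl
  have e3 : (fun y : G ↦ y * (g * g⁻¹ * g)) ∘ (fun y : G ↦ y * g⁻¹) = id := by funext x; simp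
  have h3 : mfderiv 𝓘(ℝ, E) 𝓘(ℝ, E) ((fun y : G ↦ y * (g * g⁻¹ * g)) ∘ (fun y : G ↦ y * g⁻¹)) g =
      ContinuousLinearMap.id ℝ _ := by rw [e3, mfderiv_id]
  have hid1 : MDifferentiableAt 𝓘(ℝ, E) 𝓘(ℝ, E) (fun y : G ↦ y) (g * g⁻¹) := mdifferentiableAt_id
  rw [mfderiv_comp g (hid1.groupMul mdifferentiableAt_const) hp] at h3
  have h4 := congrArg (fun A : E →L[ℝ] E ↦ A v) h3
  have h7 : (0 : E) = (fun a b : E ↦ a + b) v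
      (mfderiv 𝓘(ℝ, E) 𝓘(ℝ, E) (fun y : G ↦ g * y⁻¹ * g) g v) := by
    refine ((e1 _ fun y ↦ by group).symm.trans h).trans ?_
    exact congrArg₂ (fun a b : E ↦ a + b) h4 (e2 _ (fun y ↦ by simp) _ _)
  exact (neg_eq_of_add_eq_zero_right h7.symm).symm

end BiInvariant

/-! ### Closedness of bi-invariant forms, read in charts. -/

section LocalPrimitive

variable {E : Type*} [NormedAddCommGroup E] [NormedSpace ℝ E]
  {W : Type*} [NormedAddCommGroup W] [NormedSpace ℝ W]

/-- A one-form which is reversed by a map whose derivative at a fixed point is `-1` is closed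
at this point. -/
lemma fderiv_symmetric_of_reversed {a : E → E →L[ℝ] W} {j : E → E} {u : E}
    (ha : DifferentiableAt ℝ a u) (hj : ContDiffAt ℝ 2 j u) (hju : j u = u)
    (hd : fderiv ℝ j u = -ContinuousLinearMap.id ℝ E)
    (h : ∀ᶠ v in 𝓝 u, (a (j v)).comp (fderiv ℝ j v) = -a v) (x y : E) :
    fderiv ℝ a u x y = fderiv ℝ a u y x := by
  have hj1 : DifferentiableAt ℝ j u := hj.differentiableAt (by norm_num)
  have hdj : DifferentiableAt ℝ (fderiv ℝ j) u :=
    (hj.fderiv_right (m := 1) (by norm_num)).differentiableAt (by norm_num)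
  have hsymm : IsSymmSndFDerivAt ℝ j u := hj.isSymmSndFDerivAt (by simp)
  have haj : HasFDerivAt (fun v ↦ a (j v)) ((fderiv ℝ a u).comp (fderiv ℝ j u)) u := by
    have : HasFDerivAt a (fderiv ℝ a u) (j u) := by rw [hju]; exact ha.hasFDerivAt
    exact this.comp u hj1.hasFDerivAt
  -- Differentiating `j^* a = -a` at the fixed point, the two signs of `dj = -1` cancel, so `2 Da`
  -- equals minus `a` applied to the second derivative of `j`, which is symmetric.
  have key : ∀ x y : E, (2 : ℝ) • fderiv ℝ a u x y = -a u (fderiv ℝ (fderiv ℝ j) u x y) := by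
    intro x y
    have h1 := haj.clm_apply (hdj.hasFDerivAt.clm_apply (hasFDerivAt_const y u))
    have h2 := (ha.hasFDerivAt.clm_apply (hasFDerivAt_const y u)).neg
    have h3 : (fun v ↦ a (j v) (fderiv ℝ j v y)) =ᶠ[𝓝 u] -fun v ↦ a v y := by
      filter_upwards [h] with v hv
      exact congrArg (fun L : E →L[ℝ] W ↦ L y) hv
    have h4 := congrArg (fun L : E →L[ℝ] W ↦ L x) ((h1.congr_of_eventuallyEq h3.symm).unique h2)
    simp only [hju, hd, zero_add, ContinuousLinearMap.comp_zero,
      ContinuousLinearMap.comp_apply, ContinuousLinearMap.flip_apply, add_apply, neg_apply,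
      ContinuousLinearMap.id_apply, map_neg, neg_neg] at h4
    rw [two_smul, eq_neg_iff_add_eq_zero, add_assoc, add_comm (fderiv ℝ a u x y) (a u _), h4]
    simp
  have h5 : (2 : ℝ) • fderiv ℝ a u x y = (2 : ℝ) • fderiv ℝ a u y x := by
    rw [key, key, hsymm.eq]
  exact smul_right_injective W (two_ne_zero (α := ℝ)) h5

variable {G : Type*} [TopologicalSpace G] [ChartedSpace E G]

/-- A family of linear forms on the tangent spaces, read in the chart at `x₀`. -/
def readInChart (x₀ : G) (η : Π x : G, TangentSpace 𝓘(ℝ, E) x →L[ℝ] W) (u : E) : E →L[ℝ] W :=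
  (η ((extChartAt 𝓘(ℝ, E) x₀).symm u)).comp
    (mfderiv 𝓘(ℝ, E) 𝓘(ℝ, E) (extChartAt 𝓘(ℝ, E) x₀).symm u)

section

variable [IsManifold 𝓘(ℝ, E) ∞ G]

lemma contDiffOn_readInChart [FiniteDimensional ℝ E] (x₀ : G) (α : OneForm 𝓘(ℝ, E) G) :
    ContDiffOn ℝ ∞ (readInChart x₀ (fun x ↦ (α x : TangentSpace 𝓘(ℝ, E) x →L[ℝ] ℝ)))
      (extChartAt 𝓘(ℝ, E) x₀).target := by
  rw [contDiffOn_clm_apply]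
  intro v u hu
  set c := extChartAt 𝓘(ℝ, E) x₀ with hc
  have ho : IsOpen c.target := isOpen_extChartAt_target x₀
  have hcs : ContMDiffOn 𝓘(ℝ, E) 𝓘(ℝ, E) ∞ c.symm c.target := contMDiffOn_extChartAt_symm x₀
  have h1 : ContMDiffAt 𝓘(ℝ, E) 𝓘(ℝ, E).tangent ∞
      (fun w : E ↦ TotalSpace.mk' E (E := (TangentSpace 𝓘(ℝ, E) : G → Type _)) (c.symm w)
        (mfderiv 𝓘(ℝ, E) 𝓘(ℝ, E) c.symm w v)) u := by
    have h2 := (hcs.contMDiffOn_tangentMapWithin (m := ∞) le_rfl ho.uniqueMDiffOn)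
    have h3 : ContMDiff 𝓘(ℝ, E) 𝓘(ℝ, E).tangent ∞
      (fun w : E ↦ (⟨w, v⟩ : TangentBundle 𝓘(ℝ, E) E)) := by
      intro w
      exact contMDiffAt_vectorField_iff.2 contMDiffAt_const
    have h4 := (h2.comp h3.contMDiffOn (fun w hw ↦ hw) :
      ContMDiffOn 𝓘(ℝ, E) 𝓘(ℝ, E).tangent ∞ _ c.target)
    refine (h4.contMDiffAt (ho.mem_nhds hu)).congr_of_eventuallyEq ?_
    filter_upwards [ho.mem_nhds hu] with w hw
    simp only [Function.comp_def, tangentMapWithin]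
    rw [mfderivWithin_of_isOpen ho hw]
  have h5 : ContMDiffAt 𝓘(ℝ, E) (𝓘(ℝ, E).prod 𝓘(ℝ, E →L[ℝ] ℝ)) ∞
      (fun w ↦ TotalSpace.mk' (E →L[ℝ] ℝ)
        (E := fun x : G ↦ TangentSpace 𝓘(ℝ, E) x →L[ℝ] Trivial G ℝ x) (c.symm w) (α (c.symm w))) u :=
    (α.contMDiff (c.symm u)).comp u (hcs.contMDiffAt (ho.mem_nhds hu))
  have h6 := h5.clm_bundle_apply h1
  rw [contMDiffAt_totalSpace] at h6
  exact (contMDiffAt_iff_contDiffAt.1 h6.2).contDiffWithinAt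

end

variable [Group G] [LieGroup 𝓘(ℝ, E) ∞ G]

/-- The reversing map is the geodesic symmetry at the point with coordinate `u`, conjugated by the
chart. The point varies with `u`, so the form is closed on the whole chart. -/
lemma IsBiInvariantForm.fderiv_readInChart_symmetric
    {η : Π x : G, TangentSpace 𝓘(ℝ, E) x →L[ℝ] W} (hη : IsBiInvariantForm η) (x₀ : G) {u : E}
    (hu : u ∈ (extChartAt 𝓘(ℝ, E) x₀).target)
    (hd : DifferentiableAt ℝ (readInChart x₀ η) u) (v w : E) :
    fderiv ℝ (readInChart x₀ η) u v w = fderiv ℝ (readInChart x₀ η) u w v := by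
  set c := extChartAt 𝓘(ℝ, E) x₀ with hc
  set g : G := c.symm u with hg
  set i : G → G := fun y ↦ g * y⁻¹ * g with hi
  have hgs : g ∈ c.source := c.map_target hu
  have hgs' : g ∈ (chartAt E x₀).source := by simpa [hc] using hgs
  have hcg : c g = u := c.right_inv hu
  have hig : i g = g := by simp [hi]
  have hics : ContMDiff 𝓘(ℝ, E) 𝓘(ℝ, E) ∞ i :=
    (contMDiff_const.mul (contMDiff_inv 𝓘(ℝ, E) ∞)).mul contMDiff_const
  have hst : c.target ∈ 𝓝 u := (isOpen_extChartAt_target x₀).mem_nhds hu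
  have hcsm : ContMDiffAt 𝓘(ℝ, E) 𝓘(ℝ, E) ∞ c.symm u :=
    (contMDiffOn_extChartAt_symm x₀).contMDiffAt hst
  have hccm : ContMDiffAt 𝓘(ℝ, E) 𝓘(ℝ, E) ∞ c g := contMDiffAt_extChartAt' hgs'
  set j : E → E := c ∘ i ∘ c.symm with hj
  have hicsm : ContMDiffAt 𝓘(ℝ, E) 𝓘(ℝ, E) ∞ (i ∘ c.symm) u := (hics _).comp u hcsm
  have hicu : (i ∘ c.symm) u = g := hig
  have hjc : ContMDiffAt 𝓘(ℝ, E) 𝓘(ℝ, E) ∞ j u := by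
    refine ContMDiffAt.comp u ?_ hicsm
    rw [hicu]; exact hccm
  have hju : j u = u := by simp only [hj, Function.comp_apply, ← hg, hig, hcg]
  have hcsd : MDifferentiableAt 𝓘(ℝ, E) 𝓘(ℝ, E) c.symm u := hcsm.mdifferentiableAt (by simp)
  have hid : ∀ x, MDifferentiableAt 𝓘(ℝ, E) 𝓘(ℝ, E) i x := fun x ↦
    (hics x).mdifferentiableAt (by simp)
  have hsrc : ∀ᶠ v in 𝓝 u, i (c.symm v) ∈ c.source := by
    refine hicsm.continuousAt.eventually_mem ?_
    rw [hicu]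
    exact (isOpen_extChartAt_source x₀).mem_nhds hgs
  refine fderiv_symmetric_of_reversed (j := j) hd
    ((contMDiffAt_iff_contDiffAt.1 hjc).of_le (by norm_cast)) hju ?_ ?_ v w
  · have hccd : MDifferentiableAt 𝓘(ℝ, E) 𝓘(ℝ, E) c (i (c.symm u)) := by
      rw [← hg, hig]; exact hccm.mdifferentiableAt (by simp)
    rw [← mfderiv_eq_fderiv, hj, mfderiv_comp u hccd ((hid _).comp u hcsd),
      mfderiv_comp u (hid _) hcsd]
    have h1 := mfderiv_symmetry_self (E := E) g
    rw [← hi] at h1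
    have h2 := mfderiv_extChartAt_comp_mfderivWithin_extChartAt_symm (I := 𝓘(ℝ, E)) hu
    simp only [modelWithCornersSelf_coe, Set.range_id, mfderivWithin_univ] at h2
    ext z
    have h3 := congrArg (fun L : E →L[ℝ] E ↦ L z) h2
    have h4 := congrArg (fun L : E →L[ℝ] E ↦ L (mfderiv 𝓘(ℝ, E) 𝓘(ℝ, E) c.symm u z : E)) h1
    change (mfderiv 𝓘(ℝ, E) 𝓘(ℝ, E) c (i g) (mfderiv 𝓘(ℝ, E) 𝓘(ℝ, E) i g
      (mfderiv 𝓘(ℝ, E) 𝓘(ℝ, E) c.symm u z)) : E) = -z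
    refine (congrArg (fun y : E ↦ (mfderiv 𝓘(ℝ, E) 𝓘(ℝ, E) c (i g) y : E)) h4).trans ?_
    refine (map_neg (mfderiv 𝓘(ℝ, E) 𝓘(ℝ, E) c (i g)) _).trans ?_
    rw [hig]
    exact congrArg (fun y : E ↦ -y) h3
  · filter_upwards [hsrc, hst, (isOpen_extChartAt_target x₀).eventually_mem hu] with z hz hz' _
    have hjz : j z ∈ c.target := c.map_source hz
    have hcjz : c.symm (j z) = i (c.symm z) := c.left_inv hz
    have hzs : MDifferentiableAt 𝓘(ℝ, E) 𝓘(ℝ, E) c.symm z :=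
      mdifferentiableAt_extChartAt_symm_modelSelf hz'
    have hjs : MDifferentiableAt 𝓘(ℝ, E) 𝓘(ℝ, E) c.symm (j z) :=
      mdifferentiableAt_extChartAt_symm_modelSelf hjz
    have hcz : MDifferentiableAt 𝓘(ℝ, E) 𝓘(ℝ, E) c (i (c.symm z)) :=
      mdifferentiableAt_extChartAt (by simpa [hc] using hz)
    have hjd : MDifferentiableAt 𝓘(ℝ, E) 𝓘(ℝ, E) j z := hcz.comp z ((hid _).comp z hzs)
    -- This intertwining turns the reversal of `η` by `i` into the reversal of its chart expression
    -- by `j`.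
    have hev : c.symm ∘ j =ᶠ[𝓝 z] i ∘ c.symm := by
      have := (((hid _).comp z hzs).continuousAt).eventually_mem
        ((isOpen_extChartAt_source (I := 𝓘(ℝ, E)) x₀).mem_nhds hz)
      filter_upwards [this] with y hy
      exact c.left_inv hy
    have h1 : mfderiv 𝓘(ℝ, E) 𝓘(ℝ, E) (c.symm ∘ j) z = mfderiv 𝓘(ℝ, E) 𝓘(ℝ, E) (i ∘ c.symm) z :=
      hev.mfderiv_eq
    rw [mfderiv_comp z hjs hjd, mfderiv_comp z (hid _) hzs] at h1
    ext y
    have h2 := congrArg (fun L : E →L[ℝ] E ↦ L y) h1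
    have h3 := hη.mfderiv_symmetry g (c.symm z) (mfderiv 𝓘(ℝ, E) 𝓘(ℝ, E) c.symm z y)
    refine Eq.trans ?_ h3
    rw [← mfderiv_eq_fderiv]
    change η (c.symm (j z)) (mfderiv 𝓘(ℝ, E) 𝓘(ℝ, E) c.symm (j z) (mfderiv 𝓘(ℝ, E) 𝓘(ℝ, E) j z y))
      = _
    refine (congrArg (η (c.symm (j z))) h2).trans ?_
    rw [hcjz]
    rfl

end LocalPrimitive

/-! ### Functions with vanishing derivative are locally constant. -/

section LocallyConstant

variable {F : Type*} [NormedAddCommGroup F] [NormedSpace ℝ F]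
  {H : Type*} [TopologicalSpace H] {J : ModelWithCorners ℝ F H} [J.Boundaryless]
  {M : Type*} [TopologicalSpace M] [ChartedSpace H M] [IsManifold J 1 M]
  {W : Type*} [NormedAddCommGroup W] [NormedSpace ℝ W]

lemma eventually_eq_of_mvfderiv_eq_zero {f : M → W} {x : M}
    (h : ∀ᶠ y in 𝓝 x, MDifferentiableAt J 𝓘(ℝ, W) f y ∧ ∀ v, mvfderiv J f y v = 0) :
    ∀ᶠ y in 𝓝 x, f y = f x := by
  set c := extChartAt J x with hc
  have hcont : ContinuousAt c.symm (c x) := continuousAt_extChartAt_symm x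
  have hcx : c.symm (c x) = x := extChartAt_to_inv x
  have h1 : ∀ᶠ u in 𝓝 (c x), u ∈ c.target ∧ (MDifferentiableAt J 𝓘(ℝ, W) f (c.symm u) ∧
      ∀ v, mvfderiv J f (c.symm u) v = 0) := by
    refine Filter.Eventually.and (extChartAt_target_mem_nhds (I := J) x) ?_
    rw [ContinuousAt, hcx] at hcont
    exact hcont.eventually h
  obtain ⟨r, hr, hball⟩ := Metric.eventually_nhds_iff_ball.1 h1
  have hder : ∀ u ∈ Metric.ball (c x) r, HasFDerivAt (f ∘ c.symm) (0 : F →L[ℝ] W) u := by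
    intro u hu
    obtain ⟨hut, hfd, hf0⟩ := hball u hu
    have hs : MDifferentiableAt 𝓘(ℝ, F) J c.symm u := by
      have := mdifferentiableWithinAt_extChartAt_symm (I := J) hut
      rwa [J.range_eq_univ, mdifferentiableWithinAt_univ] at this
    have h2 := hfd.hasMFDerivAt.comp u hs.hasMFDerivAt
    have h3 := h2.hasFDerivAt
    refine h3.congr_fderiv ?_
    ext v
    exact hf0 _
  have hconst : ∀ u ∈ Metric.ball (c x) r, (f ∘ c.symm) u = (f ∘ c.symm) (c x) := by
    intro u hu
    refine (convex_ball (c x) r).is_const_of_fderivWithin_eq_zero (𝕜 := ℝ)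
      (fun v hv ↦ (hder v hv).differentiableAt.differentiableWithinAt) (fun v hv ↦ ?_) hu
      (Metric.mem_ball_self hr)
    rw [fderivWithin_of_isOpen Metric.isOpen_ball hv, (hder v hv).fderiv]
  have h4 : ∀ᶠ y in 𝓝 x, c y ∈ Metric.ball (c x) r :=
    (continuousAt_extChartAt x).eventually_mem (Metric.ball_mem_nhds _ hr)
  filter_upwards [h4, extChartAt_source_mem_nhds (I := J) x] with y hy hys
  have := hconst _ hy
  rwa [Function.comp_apply, Function.comp_apply, hcx, c.left_inv hys] at this

end LocallyConstant

/-! ### The local primitive is additive and conjugation invariant. -/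

section LocalPrimitive

variable {E : Type*} [NormedAddCommGroup E] [NormedSpace ℝ E]
  {G : Type*} [TopologicalSpace G] [ChartedSpace E G]
  {W : Type*} [NormedAddCommGroup W] [NormedSpace ℝ W]

section

variable {F : Type*} [NormedAddCommGroup F] [NormedSpace ℝ F]
  {H : Type*} [TopologicalSpace H] {J : ModelWithCorners ℝ F H}
  {M : Type*} [TopologicalSpace M] [ChartedSpace H M]
  {η : Π x : G, TangentSpace 𝓘(ℝ, E) x →L[ℝ] W}

lemma hasMFDerivAt_comp_primitive {f : G → W} {p : M → G} {z : M}
    (hf : ContMDiffAt 𝓘(ℝ, E) 𝓘(ℝ, W) ∞ f (p z) ∧ ∀ v, mvfderiv 𝓘(ℝ, E) f (p z) v = η (p z) v)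
    (hp : MDifferentiableAt J 𝓘(ℝ, E) p z) :
    MDifferentiableAt J 𝓘(ℝ, W) (fun z ↦ f (p z)) z ∧
      ∀ v, mvfderiv J (fun z ↦ f (p z)) z v = η (p z) (mfderiv J 𝓘(ℝ, E) p z v) := by
  have hfd := hf.1.mdifferentiableAt (by simp)
  refine ⟨hfd.comp z hp, fun v ↦ ?_⟩
  rw [← hf.2]
  change (mfderiv J 𝓘(ℝ, W) (f ∘ p) z v : W) = _
  rw [mfderiv_comp z hfd hp]
  rfl

end

variable [Group G]

/-- Near the identity, `f` is a smooth primitive of `η`, normalized at the identity. -/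
structure IsLocalPrimitive (f : G → W) (η : Π x : G, TangentSpace 𝓘(ℝ, E) x →L[ℝ] W) : Prop where
  map_one : f 1 = 0
  eventually : ∀ᶠ x in 𝓝 (1 : G), ContMDiffAt 𝓘(ℝ, E) 𝓘(ℝ, W) ∞ f x ∧
    ∀ v, mvfderiv 𝓘(ℝ, E) f x v = η x v

variable [LieGroup 𝓘(ℝ, E) ∞ G] {η : Π x : G, TangentSpace 𝓘(ℝ, E) x →L[ℝ] W}

/-- The Poincaré lemma on a convex ball in the chart at `1`. -/
lemma IsBiInvariantForm.exists_isLocalPrimitive [CompleteSpace W] (hη : IsBiInvariantForm η)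
    (hs : ContDiffOn ℝ ∞ (readInChart 1 η) (extChartAt 𝓘(ℝ, E) (1 : G)).target) :
    ∃ f : G → W, IsLocalPrimitive f η := by
  set c := extChartAt 𝓘(ℝ, E) (1 : G) with hc
  have ho : IsOpen c.target := isOpen_extChartAt_target 1
  obtain ⟨r, hr, hball⟩ := Metric.mem_nhds_iff.1 (extChartAt_target_mem_nhds (I := 𝓘(ℝ, E)) (1 : G))
  have hda : ∀ u ∈ Metric.ball (c 1) r, DifferentiableAt ℝ (readInChart 1 η) u := fun u hu ↦
    (hs.contDiffAt (ho.mem_nhds (hball hu))).differentiableAt (by simp)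
  obtain ⟨P, hP⟩ := (convex_ball (c 1) r).exists_forall_hasFDerivAt_of_fderiv_symmetric
    Metric.isOpen_ball (fun u hu ↦ (hda u hu).differentiableWithinAt)
    (fun u hu v w ↦ hη.fderiv_readInChart_symmetric 1 (hball hu) (hda u hu) v w)
  have hPs : ContDiffOn ℝ ∞ P (Metric.ball (c 1) r) := by
    rw [contDiffOn_infty_iff_fderiv_of_isOpen Metric.isOpen_ball]
    refine ⟨fun u hu ↦ (hP u hu).differentiableAt.differentiableWithinAt, ?_⟩
    exact (hs.mono hball).congr fun u hu ↦ (hP u hu).fderiv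
  refine ⟨fun x ↦ P (c x) - P (c 1), by simp, ?_⟩
  have h4 : ∀ᶠ y in 𝓝 (1 : G), c y ∈ Metric.ball (c 1) r :=
    (continuousAt_extChartAt 1).eventually_mem (Metric.ball_mem_nhds _ hr)
  filter_upwards [h4, extChartAt_source_mem_nhds (I := 𝓘(ℝ, E)) (1 : G)] with y hy hys
  have hys' : y ∈ (chartAt E (1 : G)).source := by simpa using hys
  have hPy : ContMDiffAt 𝓘(ℝ, E) 𝓘(ℝ, W) ∞ (fun u ↦ P u - P (c 1)) (c y) :=
    ((hPs.contDiffAt (Metric.isOpen_ball.mem_nhds hy)).sub contDiffAt_const).contMDiffAt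
  refine ⟨hPy.comp y (contMDiffAt_extChartAt' hys'), fun v ↦ ?_⟩
  have h5 : HasFDerivAt (fun u ↦ P u - P (c 1)) (readInChart 1 η (c y)) (c y) :=
    (hP _ hy).sub_const _
  have h6 := h5.hasMFDerivAt.comp y (mdifferentiableAt_extChartAt (I := 𝓘(ℝ, E)) hys').hasMFDerivAt
  have h7 := mfderivWithin_extChartAt_symm_comp_mfderiv_extChartAt' (I := 𝓘(ℝ, E)) hys
  simp only [modelWithCornersSelf_coe, Set.range_id, mfderivWithin_univ] at h7
  have h8 := congrArg (fun L : E →L[ℝ] E ↦ L v) h7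
  have hcy : c.symm (c y) = y := c.left_inv hys
  change (mfderiv 𝓘(ℝ, E) 𝓘(ℝ, W) ((fun u ↦ P u - P (c 1)) ∘ c) y v : W) = _
  rw [h6.mfderiv]
  change η (c.symm (c y)) (mfderiv 𝓘(ℝ, E) 𝓘(ℝ, E) c.symm (c y) (mfderiv 𝓘(ℝ, E) 𝓘(ℝ, E) c y v)) = _
  refine (congrArg (η (c.symm (c y))) h8).trans ?_
  rw [hcy]
  rfl

variable {f : G → W}

/-- The defect `f (x y) - f x - f y` on `G × G` has zero derivative near `(1, 1)`, because `η` is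
additive on products, and it vanishes at `(1, 1)`. -/
lemma IsLocalPrimitive.eventually_map_mul (hη : IsBiInvariantForm η) (hf : IsLocalPrimitive f η) :
    ∀ᶠ p in 𝓝 ((1 : G), (1 : G)), f (p.1 * p.2) = f p.1 + f p.2 := by
  have : ContinuousMul G := continuousMul_of_contMDiffMul 𝓘(ℝ, E) ∞
  have h1 : ∀ᶠ p in 𝓝 ((1 : G), (1 : G)),
      MDifferentiableAt (𝓘(ℝ, E).prod 𝓘(ℝ, E)) 𝓘(ℝ, W)
        (fun p : G × G ↦ f (p.1 * p.2) - (f p.1 + f p.2)) p ∧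
      ∀ v, mvfderiv (𝓘(ℝ, E).prod 𝓘(ℝ, E)) (fun p : G × G ↦ f (p.1 * p.2) - (f p.1 + f p.2)) p v
        = 0 := by
    have t1 : Filter.Tendsto (fun p : G × G ↦ p.1) (𝓝 (1, 1)) (𝓝 1) := continuous_fst.tendsto _
    have t2 : Filter.Tendsto (fun p : G × G ↦ p.2) (𝓝 (1, 1)) (𝓝 1) := continuous_snd.tendsto _
    have t3 : Filter.Tendsto (fun p : G × G ↦ p.1 * p.2) (𝓝 (1, 1)) (𝓝 1) := by
      simpa using (continuous_mul (M := G)).tendsto (1, 1)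
    filter_upwards [t1.eventually hf.eventually, t2.eventually hf.eventually,
      t3.eventually hf.eventually] with p h1 h2 h3
    have d1 : MDifferentiableAt (𝓘(ℝ, E).prod 𝓘(ℝ, E)) 𝓘(ℝ, E) (fun p : G × G ↦ p.1) p :=
      mdifferentiableAt_fst
    have d2 : MDifferentiableAt (𝓘(ℝ, E).prod 𝓘(ℝ, E)) 𝓘(ℝ, E) (fun p : G × G ↦ p.2) p :=
      mdifferentiableAt_snd
    have k1 := hasMFDerivAt_comp_primitive (p := fun p : G × G ↦ p.1) (z := p) h1 d1
    have k2 := hasMFDerivAt_comp_primitive (p := fun p : G × G ↦ p.2) (z := p) h2 d2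
    have k3 := hasMFDerivAt_comp_primitive (p := fun p : G × G ↦ p.1 * p.2) (z := p) h3
      (d1.groupMul d2)
    refine ⟨k3.1.sub (k1.1.add k2.1), fun v ↦ ?_⟩
    have e1 := mvfderiv_sub k3.1 (k1.1.add k2.1)
    have e2 := mvfderiv_add k1.1 k2.1
    have e3 := hη.mfderiv_mul d1 d2 v
    refine (congrArg (fun L ↦ L v) e1).trans ?_
    rw [e2]
    simp only [sub_apply, add_apply]
    rw [k1.2, k2.2, k3.2, e3, sub_self]
  filter_upwards [eventually_eq_of_mvfderiv_eq_zero h1] with p hp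
  simp only [mul_one, hf.map_one, add_zero, sub_zero] at hp
  exact sub_eq_zero.1 hp

lemma IsLocalPrimitive.eventually_map_conj (hη : IsBiInvariantForm η) (hf : IsLocalPrimitive f η)
    (g : G) : ∀ᶠ x in 𝓝 (1 : G), f (g * x * g⁻¹) = f x := by
  have hd : ∀ x : G, MDifferentiableAt 𝓘(ℝ, E) 𝓘(ℝ, E) (fun x : G ↦ x) x := fun x ↦
    mdifferentiableAt_id
  have hc : ∀ h x : G, MDifferentiableAt 𝓘(ℝ, E) 𝓘(ℝ, E) (fun _ : G ↦ h) x := fun h x ↦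
    mdifferentiableAt_const
  have hcd : ∀ x, MDifferentiableAt 𝓘(ℝ, E) 𝓘(ℝ, E) (fun x : G ↦ g * x * g⁻¹) x := fun x ↦
    ((hc g x).groupMul (hd x)).groupMul (hc _ x)
  have h1 : ∀ᶠ x in 𝓝 (1 : G), MDifferentiableAt 𝓘(ℝ, E) 𝓘(ℝ, W)
      (fun x ↦ f (g * x * g⁻¹) - f x) x ∧
      ∀ v, mvfderiv 𝓘(ℝ, E) (fun x ↦ f (g * x * g⁻¹) - f x) x v = 0 := by
    have t : Filter.Tendsto (fun x : G ↦ g * x * g⁻¹) (𝓝 1) (𝓝 1) := by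
      simpa [ContinuousAt] using (hcd 1).continuousAt
    filter_upwards [hf.eventually, t.eventually hf.eventually] with x h1 h2
    have k1 := hasMFDerivAt_comp_primitive (p := fun x : G ↦ x) (z := x) h1 (hd x)
    have k2 := hasMFDerivAt_comp_primitive (p := fun x : G ↦ g * x * g⁻¹) (z := x) h2 (hcd x)
    refine ⟨k2.1.sub k1.1, fun v ↦ ?_⟩
    refine (congrArg (fun L ↦ L v) (mvfderiv_sub k2.1 k1.1)).trans ?_
    simp only [sub_apply]
    rw [k1.2, k2.2, hη.mfderiv_mul ((hc g x).groupMul (hd x)) (hc _ x), hη.mfderiv_mul (hc g x) (hd x),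
      apply_mfderiv_eq_zero_of_const η (r := fun _ ↦ g) (fun _ ↦ rfl),
      apply_mfderiv_eq_zero_of_const η (r := fun _ ↦ g⁻¹) (fun _ ↦ rfl)]
    simp
  filter_upwards [eventually_eq_of_mvfderiv_eq_zero h1] with x hx
  simp only [mul_one, mul_inv_cancel, sub_self] at hx
  exact sub_eq_zero.1 hx

end LocalPrimitive

/-! ### Countably many values on the commutator subgroup, and Baire's theorem. -/

section Countability

open scoped commutatorElement

variable {G : Type*} [Group G] {W : Type*} [AddCommGroup W]

/-- The subgroup of `G × W` generated by the graph of `f` over `U`. -/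
def graphSubgroup (f : G → W) (U : Set G) : Subgroup (G × Multiplicative W) :=
  Subgroup.closure ((fun x ↦ (x, Multiplicative.ofAdd (f x))) '' U)

lemma graph_mem_graphSubgroup {f : G → W} {U : Set G} {x : G} (hx : x ∈ U) :
    (x, Multiplicative.ofAdd (f x)) ∈ graphSubgroup f U :=
  Subgroup.subset_closure ⟨x, hx, rfl⟩

lemma map_one_eq_zero_of_additive {f : G → W} {V : Set G} (h1 : (1 : G) ∈ V)
    (hadd : ∀ x ∈ V, ∀ y ∈ V, f (x * y) = f x + f y) : f 1 = 0 := by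
  have := hadd 1 h1 1 h1
  rw [mul_one] at this
  exact left_eq_add.1 this

variable [TopologicalSpace G] [IsTopologicalGroup G]

/-- Connectedness lets one travel from `1` to any point of `V` in small steps; by additivity a step
from `x` to `y` multiplies by the graph element over `x⁻¹ y`, which lies over `U`. -/
lemma graphSubgroup_le_of_mem_nhds {f : G → W} {U V : Set G} (hV : IsPreconnected V)
    (h1 : (1 : G) ∈ V) (hVo : IsOpen V) (hU : U ∈ 𝓝 (1 : G))
    (hadd : ∀ x ∈ V, ∀ y ∈ V, f (x * y) = f x + f y) :
    graphSubgroup f V ≤ graphSubgroup f U := by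
  rw [graphSubgroup, Subgroup.closure_le]
  rintro _ ⟨x, hx, rfl⟩
  have key := hV.induction₂ (fun x y ↦ (x, Multiplicative.ofAdd (f x))⁻¹ *
    (y, Multiplicative.ofAdd (f y)) ∈ graphSubgroup f U) ?_ ?_ ?_ h1 hx
  · have : ((1 : G), Multiplicative.ofAdd (f 1)) = 1 := by
      rw [map_one_eq_zero_of_additive h1 hadd]; rfl
    rwa [this, inv_one, one_mul] at key
  · intro x hx
    have t : Filter.Tendsto (fun y ↦ x⁻¹ * y) (𝓝[V] x) (𝓝 1) := by
      have : Filter.Tendsto (fun y ↦ x⁻¹ * y) (𝓝 x) (𝓝 (x⁻¹ * x)) :=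
        (continuous_const_mul x⁻¹).tendsto x
      rw [inv_mul_cancel] at this
      exact this.mono_left nhdsWithin_le_nhds
    filter_upwards [t.eventually hU, t.eventually (hVo.mem_nhds h1)] with y hy hy'
    have e := hadd x hx _ hy'
    rw [mul_inv_cancel_left] at e
    have : (x, Multiplicative.ofAdd (f x))⁻¹ * (y, Multiplicative.ofAdd (f y)) =
        (x⁻¹ * y, Multiplicative.ofAdd (f (x⁻¹ * y))) := by
      rw [e, ofAdd_add]
      ext <;> simp
    rw [this]
    exact graph_mem_graphSubgroup hy
  · intro x y z _ _ _ hxy hyz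
    have := mul_mem hxy hyz
    rwa [mul_assoc, mul_inv_cancel_left] at this
  · intro x y _ _ hxy
    have := inv_mem hxy
    rwa [mul_inv_rev, inv_inv] at this

/-- Conjugation invariance holds only on a neighbourhood depending on `g`, but the graph over that
neighbourhood already generates the whole subgroup. -/
lemma graphSubgroup_normal {f : G → W} {V : Set G} (hV : IsPreconnected V)
    (h1 : (1 : G) ∈ V) (hVo : IsOpen V)
    (hadd : ∀ x ∈ V, ∀ y ∈ V, f (x * y) = f x + f y)
    (hconj : ∀ g : G, ∀ᶠ x in 𝓝 (1 : G), f (g * x * g⁻¹) = f x) :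
    (graphSubgroup f V).Normal := by
  constructor
  intro n hn g
  have t : Filter.Tendsto (fun x ↦ g.1 * x * g.1⁻¹) (𝓝 1) (𝓝 1) := by
    have : Continuous fun x ↦ g.1 * x * g.1⁻¹ := by fun_prop
    simpa using this.tendsto 1
  have hU : {x | f (g.1 * x * g.1⁻¹) = f x ∧ g.1 * x * g.1⁻¹ ∈ V} ∈ 𝓝 (1 : G) :=
    (hconj g.1).and (t.eventually (hVo.mem_nhds h1))
  have hn' := graphSubgroup_le_of_mem_nhds hV h1 hVo hU hadd hn
  have hle : graphSubgroup f {x | f (g.1 * x * g.1⁻¹) = f x ∧ g.1 * x * g.1⁻¹ ∈ V} ≤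
      (graphSubgroup f V).comap (MulAut.conj g).toMonoidHom := by
    conv_lhs => rw [graphSubgroup]
    rw [Subgroup.closure_le]
    rintro _ ⟨x, ⟨hx, hx'⟩, rfl⟩
    have : MulAut.conj g (x, Multiplicative.ofAdd (f x)) =
        (g.1 * x * g.1⁻¹, Multiplicative.ofAdd (f (g.1 * x * g.1⁻¹))) := by
      rw [hx]
      ext <;> simp
    have h2 := graph_mem_graphSubgroup (f := f) hx'
    rw [← this] at h2
    exact h2
  exact hle hn'

/-- Words are rewritten letter by letter: in `d v u` the factor `v` is replaced by a nearby `e ∈ D`,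
absorbed into `d`, and the new last factor is `e⁻¹ v u`, close to `u`. With `D` countable, only the
last factor ranges over an uncountable set. -/
lemma exists_mem_closure_mul_graph {f : G → W} {V D : Set G} (h1 : (1 : G) ∈ V) (hVo : IsOpen V)
    (hD : Dense D) (hadd : ∀ x ∈ V, ∀ y ∈ V, f (x * y) = f x + f y)
    {h : G × Multiplicative W} (hh : h ∈ graphSubgroup f (V ∩ V⁻¹)) :
    ∃ d ∈ graphSubgroup f (D ∩ (V ∩ V⁻¹)), ∃ v ∈ V ∩ V⁻¹,
      h = d * (v, Multiplicative.ofAdd (f v)) := by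
  have hf1 := map_one_eq_zero_of_additive h1 hadd
  have hUo : IsOpen (V ∩ V⁻¹) := hVo.inter hVo.inv
  have step : ∀ d ∈ graphSubgroup f (D ∩ (V ∩ V⁻¹)), ∀ v ∈ V ∩ V⁻¹, ∀ u ∈ V ∩ V⁻¹,
      ∃ d' ∈ graphSubgroup f (D ∩ (V ∩ V⁻¹)), ∃ v' ∈ V ∩ V⁻¹,
        d * (v, Multiplicative.ofAdd (f v)) * (u, Multiplicative.ofAdd (f u)) =
          d' * (v', Multiplicative.ofAdd (f v')) := by
    intro d hd v hv u hu
    have hO : {e : G | e⁻¹ * v ∈ V ∧ e⁻¹ * v * u ∈ V ∩ V⁻¹ ∧ e ∈ V ∩ V⁻¹} ∈ 𝓝 v := by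
      have c1 : Continuous fun e : G ↦ e⁻¹ * v := by fun_prop
      have c2 : Continuous fun e : G ↦ e⁻¹ * v * u := by fun_prop
      refine ((c1.tendsto v).eventually (hVo.mem_nhds ?_)).and
        (((c2.tendsto v).eventually (hUo.mem_nhds ?_)).and (hUo.mem_nhds hv))
      · simpa using h1
      · simpa using hu
    obtain ⟨e, heD, he1, he2, he3⟩ := hD.inter_nhds_nonempty hO
    refine ⟨d * (e, Multiplicative.ofAdd (f e)), mul_mem hd (graph_mem_graphSubgroup ⟨heD, he3⟩),
      e⁻¹ * v * u, he2, ?_⟩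
    have e1 := hadd e he3.1 _ he1
    rw [mul_inv_cancel_left] at e1
    have e2 := hadd _ he1 u hu.1
    rw [e2, e1]
    ext
    · simp [mul_assoc]
    · simp [ofAdd_add, mul_assoc]
  induction hh using Subgroup.closure_induction_right with
  | one =>
    refine ⟨1, one_mem _, 1, ⟨h1, by simpa using h1⟩, ?_⟩
    rw [hf1, one_mul]; rfl
  | mul_right x hx y hy ih =>
    obtain ⟨d, hd, v, hv, rfl⟩ := ih
    obtain ⟨u, hu, rfl⟩ := hy
    exact step d hd v hv u hu
  | mul_inv_cancel x hx y hy ih =>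
    obtain ⟨d, hd, v, hv, rfl⟩ := ih
    obtain ⟨u, hu, rfl⟩ := hy
    have hu' : u⁻¹ ∈ V ∩ V⁻¹ := ⟨hu.2, by simpa using hu.1⟩
    have e := hadd u hu.1 u⁻¹ hu'.1
    rw [mul_inv_cancel, hf1] at e
    have e2 : (u, Multiplicative.ofAdd (f u))⁻¹ = (u⁻¹, Multiplicative.ofAdd (f u⁻¹)) := by
      rw [(neg_eq_of_add_eq_zero_right e.symm).symm, ofAdd_neg]
      rfl
    simp only [e2]
    exact step d hd v hv _ hu'

lemma countable_closure_of_countable {Γ : Type*} [Group Γ] {s : Set Γ} (hs : s.Countable) :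
    (Subgroup.closure s : Set Γ).Countable := by
  have := hs.to_subtype
  rw [← Subtype.range_coe (s := s), ← FreeGroup.range_lift_eq_closure, MonoidHom.coe_range]
  exact Set.countable_range _

variable [SecondCountableTopology G]

/-- Over `1` the last factor `v` must be the inverse of the first component of `d`, so `r` is
determined by `d`, which ranges over a countable group. -/
lemma countable_fiber_graphSubgroup {f : G → W} {V : Set G} (hV : IsPreconnected V)
    (h1 : (1 : G) ∈ V) (hVo : IsOpen V)
    (hadd : ∀ x ∈ V, ∀ y ∈ V, f (x * y) = f x + f y) :
    {r : Multiplicative W | ((1 : G), r) ∈ graphSubgroup f V}.Countable := by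
  obtain ⟨D, hDc, hD⟩ := TopologicalSpace.exists_countable_dense G
  have hU : V ∩ V⁻¹ ∈ 𝓝 (1 : G) :=
    (hVo.inter hVo.inv).mem_nhds ⟨h1, by simpa using h1⟩
  have hc : (graphSubgroup f (D ∩ (V ∩ V⁻¹)) : Set (G × Multiplicative W)).Countable :=
    countable_closure_of_countable ((hDc.mono Set.inter_subset_left).image _)
  refine (hc.image fun d ↦ d.2 * Multiplicative.ofAdd (f d.1⁻¹)).mono ?_
  intro r hr
  obtain ⟨d, hd, v, hv, e⟩ := exists_mem_closure_mul_graph h1 hVo hD hadd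
    (graphSubgroup_le_of_mem_nhds hV h1 hVo hU hadd hr)
  refine ⟨d, hd, ?_⟩
  have e1 : (1 : G) = d.1 * v := congrArg Prod.fst e
  have e2 : r = d.2 * Multiplicative.ofAdd (f v) := congrArg Prod.snd e
  rw [e2, eq_inv_of_mul_eq_one_right e1.symm]

/-- A local homomorphism to an abelian group which is locally invariant under conjugation takes
only countably many values on the commutator subgroup. -/
theorem countable_image_commutator {f : G → W} {V : Set G} (hV : IsPreconnected V)
    (h1 : (1 : G) ∈ V) (hVo : IsOpen V)
    (hadd : ∀ x ∈ V, ∀ y ∈ V, f (x * y) = f x + f y)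
    (hconj : ∀ g : G, ∀ᶠ x in 𝓝 (1 : G), f (g * x * g⁻¹) = f x) :
    (f '' (V ∩ commutator G)).Countable := by
  have hnormal := graphSubgroup_normal hV h1 hVo hadd hconj
  set S := graphSubgroup f V with hS
  set q : G × Multiplicative W →* (G × Multiplicative W) ⧸ S := QuotientGroup.mk' S with hq
  have hqS : ∀ x, q x = 1 ↔ x ∈ S := fun x ↦ QuotientGroup.eq_one_iff x
  obtain ⟨D, hDc, hD⟩ := TopologicalSpace.exists_countable_dense G
  set C : Subgroup ((G × Multiplicative W) ⧸ S) :=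
    Subgroup.closure ((fun d ↦ q (d, 1)) '' D) with hC
  have hCc : (C : Set ((G × Multiplicative W) ⧸ S)).Countable :=
    countable_closure_of_countable (hDc.image _)
  -- A dense element `d` with `d⁻¹ g ∈ V` moves `g` into `V`, where the graph, trivial in the
  -- quotient, trades the group component for an element of `W`.
  have hdec : ∀ x, ∃ c ∈ C, ∃ s : Multiplicative W, x = c * q (1, s) := by
    intro x
    obtain ⟨⟨g, s⟩, rfl⟩ := QuotientGroup.mk'_surjective S x
    have hO : {e : G | e⁻¹ * g ∈ V} ∈ 𝓝 g := by
      have c1 : Continuous fun e : G ↦ e⁻¹ * g := by fun_prop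
      exact (c1.tendsto g).eventually (hVo.mem_nhds (by simpa using h1))
    obtain ⟨d, hdD, hd⟩ := hD.inter_nhds_nonempty hO
    refine ⟨q (d, 1), Subgroup.subset_closure ⟨d, hdD, rfl⟩,
      s * (Multiplicative.ofAdd (f (d⁻¹ * g)))⁻¹, ?_⟩
    have e : (g, s) = (d, 1) * (d⁻¹ * g, Multiplicative.ofAdd (f (d⁻¹ * g))) *
        (1, s * (Multiplicative.ofAdd (f (d⁻¹ * g)))⁻¹) := by
      ext <;> simp
    change q (g, s) = _
    rw [e, map_mul, map_mul, (hqS _).2 (graph_mem_graphSubgroup hd), mul_one]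
  have hcen : ∀ (s : Multiplicative W) x, q (1, s) * x = x * q (1, s) := by
    intro s x
    obtain ⟨⟨g, t⟩, rfl⟩ := QuotientGroup.mk'_surjective S x
    change q (1, s) * q (g, t) = q (g, t) * q (1, s)
    rw [← map_mul, ← map_mul]
    congr 1
    ext
    · simp
    · simp [mul_comm]
  -- Central factors drop out of commutators, leaving commutators of elements of the countable
  -- subgroup `C`.
  have hcomm : ⁅(⊤ : Subgroup ((G × Multiplicative W) ⧸ S)),
      (⊤ : Subgroup ((G × Multiplicative W) ⧸ S))⁆ ≤ C := by
    rw [Subgroup.commutator_le]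
    intro x _ y _
    obtain ⟨c, hc, s, rfl⟩ := hdec x
    obtain ⟨d, hd, t, rfl⟩ := hdec y
    have : ⁅c * q (1, s), d * q (1, t)⁆ = ⁅c, d⁆ := by
      rw [commutatorElement_def, commutatorElement_def]
      calc c * q (1, s) * (d * q (1, t)) * (c * q (1, s))⁻¹ * (d * q (1, t))⁻¹
          = c * (q (1, s) * d) * (q (1, t) * (q (1, s))⁻¹ * c⁻¹ * (q (1, t))⁻¹) * d⁻¹ := by group
        _ = c * (d * q (1, s)) * ((q (1, s))⁻¹ * c⁻¹) * d⁻¹ := by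
          rw [hcen s d, mul_assoc (q (1, t)), hcen t, mul_inv_cancel_right]
        _ = c * d * c⁻¹ * d⁻¹ := by group
    rw [this, commutatorElement_def]
    exact mul_mem (mul_mem (mul_mem hc hd) (inv_mem hc)) (inv_mem hd)
  have hNC : ∀ n ∈ commutator G, q (n, 1) ∈ C := by
    intro n hn
    refine hcomm ?_
    have h2 : q (n, 1) ∈ (commutator G).map (q.comp (MonoidHom.inl G (Multiplicative W))) :=
      ⟨n, hn, rfl⟩
    rw [commutator_def, Subgroup.map_commutator] at h2
    exact Subgroup.commutator_mono le_top le_top h2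
  -- Each nonempty fibre of `s ↦ q (1, s)` is a coset of the countable fibre of `S` over `1`.
  have hfib : {s : Multiplicative W | q (1, s) ∈ C}.Countable := by
    have hP := countable_fiber_graphSubgroup hV h1 hVo hadd
    have : {s : Multiplicative W | q (1, s) ∈ C} ⊆ ⋃ c ∈ C, {s | q (1, s) = c} := by
      intro s hs
      simpa using hs
    refine Set.Countable.mono this (hCc.biUnion fun c _ ↦ ?_)
    rcases Set.eq_empty_or_nonempty {s : Multiplicative W | q (1, s) = c} with h0 | ⟨s₀, hs₀⟩
    · rw [h0]; exact Set.countable_empty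
    · refine (hP.image fun r ↦ s₀ * r).mono ?_
      intro s hs
      refine ⟨s₀⁻¹ * s, ?_, by simp⟩
      have e : ((1 : G), s₀⁻¹ * s) = (1, s₀)⁻¹ * (1, s) := by ext <;> simp
      change ((1 : G), s₀⁻¹ * s) ∈ S
      rw [← hqS, e, map_mul, map_inv, hs, hs₀, inv_mul_cancel]
  refine (hfib.image fun s ↦ -Multiplicative.toAdd s).mono ?_
  rintro _ ⟨x, ⟨hxV, hxN⟩, rfl⟩
  refine ⟨Multiplicative.ofAdd (-f x), ?_, by simp⟩
  have e : ((1 : G), Multiplicative.ofAdd (-f x)) = (x, Multiplicative.ofAdd (f x))⁻¹ * (x, 1) := by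
    ext <;> simp
  change q (1, Multiplicative.ofAdd (-f x)) ∈ C
  rw [e, map_mul, map_inv, (hqS _).2 (graph_mem_graphSubgroup hxV), inv_one, one_mul]
  exact hNC x hxN

/-- If moreover the commutator subgroup is closed, such a local homomorphism vanishes on it near
the identity. -/
theorem eventually_eq_zero_of_mem_commutator [T2Space G] [LocallyCompactSpace G]
    [TopologicalSpace W] [T1Space W] (hclosed : IsClosed (commutator G : Set G))
    {f : G → W} {V : Set G} (hV : IsPreconnected V)
    (h1 : (1 : G) ∈ V) (hVo : IsOpen V) (hf : ContinuousOn f V)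
    (hadd : ∀ x ∈ V, ∀ y ∈ V, f (x * y) = f x + f y)
    (hconj : ∀ g : G, ∀ᶠ x in 𝓝 (1 : G), f (g * x * g⁻¹) = f x) :
    ∀ᶠ x in 𝓝 (1 : G), x ∈ commutator G → f x = 0 := by
  have hcount := countable_image_commutator hV h1 hVo hadd hconj
  set T : Set G := V ∩ commutator G with hT
  have : LocallyCompactSpace T := (hVo.isLocallyClosed.inter hclosed.isLocallyClosed).locallyCompactSpace
  have : Nonempty T := ⟨1, h1, one_mem _⟩
  have hcs := hcount.to_subtype
  have hfT : Continuous fun x : T ↦ f x := (hf.mono Set.inter_subset_left).domRestrict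
  -- Baire category on the locally compact space `T`: it is a countable union of closed level sets
  -- of `f`, so one of them has an interior point.
  obtain ⟨⟨r, _⟩, hr⟩ := nonempty_interior_of_iUnion_of_closed
    (f := fun r : f '' T ↦ {x : T | f x = r})
    (fun r ↦ isClosed_singleton.preimage hfT)
    (Set.eq_univ_of_forall fun x ↦ Set.mem_iUnion.2 ⟨⟨f x, x, x.2, rfl⟩, rfl⟩)
  obtain ⟨⟨x, hxV, hxN⟩, hx⟩ := hr
  have hx2 := mem_interior_iff_mem_nhds.1 hx
  have hxr : (⟨x, hxV, hxN⟩ : T) ∈ {x : T | f x = r} := mem_of_mem_nhds hx2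
  replace hxr : f x = r := hxr
  rw [mem_nhds_subtype] at hx2
  obtain ⟨O, hO, hOs⟩ := hx2
  have t : Filter.Tendsto (fun n ↦ x * n) (𝓝 1) (𝓝 x) := by
    simpa using (continuous_const_mul x).tendsto 1
  filter_upwards [t.eventually hO, t.eventually (hVo.mem_nhds hxV), hVo.mem_nhds h1]
    with n hn hnV hnV' hnN
  have h2 : f (x * n) = r := hOs (a := ⟨x * n, hnV, mul_mem hxN hnN⟩) hn
  rw [hadd x hxV n hnV', hxr] at h2
  exact add_eq_left.1 h2

end Countability

/-! ### Bi-invariant forms as `Ad`-invariant linear forms at the identity. -/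

section InvariantForms

variable {E : Type*} [NormedAddCommGroup E] [NormedSpace ℝ E]
  {G : Type*} [TopologicalSpace G] [ChartedSpace E G] [Group G]

/-- The adjoint action, as the derivative of conjugation at the identity. -/
def adjointMap (g : G) : E →L[ℝ] E :=
  mfderiv 𝓘(ℝ, E) 𝓘(ℝ, E) (fun x : G ↦ g * x * g⁻¹) 1

variable (E G) in
/-- The span of the vectors `Ad_g v - v`. -/
def adjointCommutatorSpan : Submodule ℝ E :=
  Submodule.span ℝ {w | ∃ (g : G) (v : E), w = adjointMap g v - v}

/-- The left-invariant one-form whose value at the identity is `L`. -/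
def leftInvariantForm (L : E →L[ℝ] ℝ) (g : G) : TangentSpace 𝓘(ℝ, E) g →L[ℝ] ℝ :=
  L.comp (mfderiv 𝓘(ℝ, E) 𝓘(ℝ, E) (fun x : G ↦ g⁻¹ * x) g)

lemma leftInvariantForm_one (L : E →L[ℝ] ℝ) (v : E) : leftInvariantForm (1 : G) (L := L) v = L v := by
  have h : (fun x : G ↦ (1 : G)⁻¹ * x) = id := by funext x; simp
  change L (mfderiv 𝓘(ℝ, E) 𝓘(ℝ, E) (fun x : G ↦ (1 : G)⁻¹ * x) 1 v) = L v
  rw [h, mfderiv_id]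
  rfl

variable [LieGroup 𝓘(ℝ, E) ∞ G]

lemma mdifferentiableAt_mul_left_const (g x : G) :
    MDifferentiableAt 𝓘(ℝ, E) 𝓘(ℝ, E) (fun y : G ↦ g * y) x :=
  (contMDiff_mul_left (I := 𝓘(ℝ, E)) (n := ∞)).contMDiffAt.mdifferentiableAt (by simp)

lemma mdifferentiableAt_mul_right_const (g x : G) :
    MDifferentiableAt 𝓘(ℝ, E) 𝓘(ℝ, E) (fun y : G ↦ y * g) x :=
  (contMDiff_mul_right (I := 𝓘(ℝ, E)) (n := ∞)).contMDiffAt.mdifferentiableAt (by simp)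

lemma mdifferentiableAt_conj (g x : G) :
    MDifferentiableAt 𝓘(ℝ, E) 𝓘(ℝ, E) (fun y : G ↦ g * y * g⁻¹) x :=
  (mdifferentiableAt_mul_left_const g x).groupMul mdifferentiableAt_const

/-- For right invariance, `(x h)⁻¹ (y h) = h⁻¹ (x⁻¹ y) h`: a right translation costs one
conjugation, and `L` does not change under `Ad`. -/
lemma isBiInvariantForm_leftInvariantForm {L : E →L[ℝ] ℝ}
    (hL : adjointCommutatorSpan E G ≤ LinearMap.ker (L : E →ₗ[ℝ] ℝ)) :
    IsBiInvariantForm (leftInvariantForm (G := G) L) where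
  left h x v := by
    have h1 : (fun y : G ↦ (h * x)⁻¹ * y) ∘ (fun y : G ↦ h * y) = fun y ↦ x⁻¹ * y := by
      funext y; simp
    have h2 := mfderiv_comp x (mdifferentiableAt_mul_left_const (E := E) (h * x)⁻¹ (h * x))
      (mdifferentiableAt_mul_left_const h x)
    rw [h1] at h2
    exact (congrArg (fun A : E →L[ℝ] E ↦ L (A v)) h2).symm
  right h x v := by
    have h1 : (fun y : G ↦ (x * h)⁻¹ * y) ∘ (fun y : G ↦ y * h) =
        (fun y ↦ h⁻¹ * y * h⁻¹⁻¹) ∘ fun y ↦ x⁻¹ * y := by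
      funext y; simp [mul_assoc]
    have h2 := mfderiv_comp x (mdifferentiableAt_mul_left_const (E := E) (x * h)⁻¹ (x * h))
      (mdifferentiableAt_mul_right_const h x)
    have h3 := mfderiv_comp x (mdifferentiableAt_conj (E := E) h⁻¹ (x⁻¹ * x))
      (mdifferentiableAt_mul_left_const x⁻¹ x)
    rw [h1] at h2
    have h4 := h2.symm.trans h3
    refine (congrArg (fun A : E →L[ℝ] E ↦ L (A v)) h4).trans ?_
    set w : E := mfderiv 𝓘(ℝ, E) 𝓘(ℝ, E) (fun y : G ↦ x⁻¹ * y) x v with hw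
    have h5 : ∀ z : G, z = 1 → L (mfderiv 𝓘(ℝ, E) 𝓘(ℝ, E) (fun y : G ↦ h⁻¹ * y * h⁻¹⁻¹) z w) = L w := by
      rintro _ rfl
      have : L (adjointMap h⁻¹ w - w) = 0 := hL (Submodule.subset_span ⟨h⁻¹, w, rfl⟩)
      rw [map_sub, sub_eq_zero] at this
      exact this
    exact h5 _ (inv_mul_cancel x)

lemma contMDiff_leftInvariantForm (L : E →L[ℝ] ℝ) :
    ContMDiff 𝓘(ℝ, E) (𝓘(ℝ, E).prod 𝓘(ℝ, E →L[ℝ] ℝ)) ∞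
      (fun g : G ↦ (⟨g, leftInvariantForm L g⟩ : TotalSpace (E →L[ℝ] ℝ)
        fun x : G ↦ TangentSpace 𝓘(ℝ, E) x →L[ℝ] Trivial G ℝ x)) := by
  intro g₀
  rw [contMDiffAt_hom_bundle]
  refine ⟨contMDiffAt_id, ?_⟩
  have hm : ContMDiffAt (𝓘(ℝ, E).prod 𝓘(ℝ, E)) 𝓘(ℝ, E) ∞
      (Function.uncurry fun n x : G ↦ n⁻¹ * x) (g₀, g₀) :=
    ((contMDiff_inv 𝓘(ℝ, E) ∞).comp contMDiff_fst |>.mul contMDiff_snd).contMDiffAt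
  have h1 := ContMDiffAt.mfderiv (m := ∞) (fun n x : G ↦ n⁻¹ * x) (fun n : G ↦ n) hm contMDiffAt_id
    le_rfl
  have h2 : ContMDiffAt 𝓘(ℝ, E) 𝓘(ℝ, E →L[ℝ] ℝ) ∞ (fun x ↦ L.comp (inTangentCoordinates 𝓘(ℝ, E)
      𝓘(ℝ, E) (fun n : G ↦ n) (fun x : G ↦ x⁻¹ * x)
      (fun x : G ↦ mfderiv 𝓘(ℝ, E) 𝓘(ℝ, E) (fun y : G ↦ x⁻¹ * y) x) g₀ x)) g₀ :=
    contMDiffAt_const.clm_comp h1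
  refine h2.congr_of_eventuallyEq (Filter.Eventually.of_forall fun x ↦ ?_)
  -- The values of `x⁻¹ * x` are all `1`, so the target trivialization is the identity; equality
  -- hypotheses avoid rewriting in dependent types.
  have h3 : ∀ a b : G, a = 1 → b = 1 →
      (trivializationAt E (TangentSpace 𝓘(ℝ, E)) a).continuousLinearMapAt ℝ b =
        ContinuousLinearMap.id ℝ E := by
    rintro _ _ rfl rfl
    rw [TangentBundle.continuousLinearMapAt_trivializationAt (mem_chart_source E (1 : G))]
    exact mfderiv_extChartAt_self
  simp only [inTangentCoordinates, ContinuousLinearMap.inCoordinates]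
  rw [h3 _ _ (inv_mul_cancel g₀) (inv_mul_cancel x)]
  ext v
  simp
  rfl

lemma isBiInvariantForm_of_mem {α : OneForm 𝓘(ℝ, E) G} (hα : α ∈ biInvariantOneForms 𝓘(ℝ, E) G) :
    IsBiInvariantForm (fun x : G ↦ (α x : TangentSpace 𝓘(ℝ, E) x →L[ℝ] ℝ)) where
  left h x v := ((hα h).1 x v).symm
  right h x v := ((hα h).2 x v).symm

/-- The left-invariant extension of an `Ad`-invariant linear form is a bi-invariant one-form. -/
lemma exists_mem_biInvariantOneForms {L : E →L[ℝ] ℝ}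
    (hL : adjointCommutatorSpan E G ≤ LinearMap.ker (L : E →ₗ[ℝ] ℝ)) :
    ∃ α ∈ biInvariantOneForms 𝓘(ℝ, E) G, ∀ v : E, α (1 : G) v = L v := by
  have h := isBiInvariantForm_leftInvariantForm hL
  refine ⟨⟨leftInvariantForm L, contMDiff_leftInvariantForm L⟩, fun g ↦ ⟨fun x v ↦ ?_, fun x v ↦ ?_⟩,
    fun v ↦ leftInvariantForm_one L v⟩
  · exact (h.left g x v).symm
  · exact (h.right g x v).symm

lemma eq_zero_of_mem_biInvariantOneForms {α : OneForm 𝓘(ℝ, E) G}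
    (hα : α ∈ biInvariantOneForms 𝓘(ℝ, E) G) (h : ∀ v : E, α (1 : G) v = 0) : α = 0 := by
  ext x v
  have h1 := (isBiInvariantForm_of_mem hα).left x⁻¹ x v
  have h2 : ∀ (y : G) (w : E), y = 1 → (α y w : ℝ) = 0 := by
    rintro _ w rfl
    exact h w
  exact h1.symm.trans (h2 _ _ (inv_mul_cancel x))

/-- The one-forms `b i` as the components of a form with values in Euclidean space. -/
def vectorForm {k : ℕ} (b : Fin k → OneForm 𝓘(ℝ, E) G) (x : G) :
    TangentSpace 𝓘(ℝ, E) x →L[ℝ] EuclideanSpace ℝ (Fin k) :=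
  ((PiLp.continuousLinearEquiv 2 ℝ (fun _ : Fin k ↦ ℝ)).symm :
    (Fin k → ℝ) →L[ℝ] EuclideanSpace ℝ (Fin k)).comp
    (ContinuousLinearMap.pi fun i ↦ (b i x : TangentSpace 𝓘(ℝ, E) x →L[ℝ] ℝ))

variable {k : ℕ} (b : Module.Basis (Fin k) ℝ (biInvariantOneForms 𝓘(ℝ, E) G))

lemma isBiInvariantForm_vectorForm :
    IsBiInvariantForm (vectorForm fun i ↦ (b i : OneForm 𝓘(ℝ, E) G)) where
  left h x v := by
    ext i
    exact (isBiInvariantForm_of_mem (b i).2).left h x v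
  right h x v := by
    ext i
    exact (isBiInvariantForm_of_mem (b i).2).right h x v

/-- Every bi-invariant one-form is a linear function of the basis forms. -/
lemma exists_eq_comp_vectorForm (α : biInvariantOneForms 𝓘(ℝ, E) G) :
    ∃ l : EuclideanSpace ℝ (Fin k) →L[ℝ] ℝ, ∀ (x : G) (v : TangentSpace 𝓘(ℝ, E) x),
      (α : OneForm 𝓘(ℝ, E) G) x v = l (vectorForm (fun i ↦ (b i : OneForm 𝓘(ℝ, E) G)) x v) := by
  refine ⟨∑ j, b.repr α j • EuclideanSpace.proj j, fun x v ↦ ?_⟩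
  let ev : biInvariantOneForms 𝓘(ℝ, E) G →ₗ[ℝ] ℝ :=
    { toFun := fun α ↦ (α : OneForm 𝓘(ℝ, E) G) x v
      map_add' := fun _ _ ↦ rfl
      map_smul' := fun _ _ ↦ rfl }
  have h1 : ev α = ∑ j, b.repr α j * ev (b j) := by
    conv_lhs => rw [← b.sum_repr α]
    rw [map_sum]
    exact Finset.sum_congr rfl fun j _ ↦ ev.map_smul _ (b j)
  refine Eq.trans h1 ?_
  rw [sum_apply]
  rfl

/-- A functional vanishing on a proper range would give a nontrivial combination of the basis forms
that vanishes at `1`, hence everywhere. -/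
lemma surjective_vectorForm_one :
    Function.Surjective (vectorForm (fun i ↦ (b i : OneForm 𝓘(ℝ, E) G)) (1 : G)) := by
  set A : E →L[ℝ] EuclideanSpace ℝ (Fin k) := vectorForm (fun i ↦ (b i : OneForm 𝓘(ℝ, E) G)) (1 : G)
    with hA
  change Function.Surjective A
  intro w
  by_contra hcon
  have hw : w ∉ LinearMap.range (A : E →ₗ[ℝ] EuclideanSpace ℝ (Fin k)) := hcon
  obtain ⟨φ, hφw, hφ⟩ := Submodule.exists_le_ker_of_notMem hw
  have hsum : ∀ w : EuclideanSpace ℝ (Fin k), φ w = ∑ i, w i * φ (EuclideanSpace.single i 1) := by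
    intro w
    conv_lhs => rw [← (EuclideanSpace.basisFun (Fin k) ℝ).sum_repr w]
    simp
  set β : biInvariantOneForms 𝓘(ℝ, E) G :=
    b.equivFun.symm (fun i ↦ φ (EuclideanSpace.single i 1)) with hβ
  have h0 : β = 0 := by
    refine Subtype.ext (eq_zero_of_mem_biInvariantOneForms β.2 fun v ↦ ?_)
    let ev : biInvariantOneForms 𝓘(ℝ, E) G →ₗ[ℝ] ℝ :=
      { toFun := fun α ↦ (α : OneForm 𝓘(ℝ, E) G) (1 : G) v
        map_add' := fun _ _ ↦ rfl
        map_smul' := fun _ _ ↦ rfl }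
    change ev β = 0
    rw [hβ, b.equivFun_symm_apply, map_sum]
    have h1 : φ (A v) = 0 := hφ ⟨v, rfl⟩
    rw [hsum] at h1
    rw [← h1]
    exact Finset.sum_congr rfl fun i _ ↦
      (ev.map_smul _ (b i)).trans (mul_comm _ _)
  have h1 := (LinearEquiv.map_eq_zero_iff b.equivFun.symm).1 h0
  apply hφw
  rw [hsum]
  exact Finset.sum_eq_zero fun i _ ↦ by
    rw [show φ (EuclideanSpace.single i 1) = 0 from congrFun h1 i, mul_zero]

variable [FiniteDimensional ℝ E]

instance : Module.Finite ℝ (biInvariantOneForms 𝓘(ℝ, E) G) := by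
  let ev : biInvariantOneForms 𝓘(ℝ, E) G →ₗ[ℝ] (E →L[ℝ] ℝ) :=
    { toFun := fun α ↦ (α : OneForm 𝓘(ℝ, E) G) (1 : G)
      map_add' := fun _ _ ↦ rfl
      map_smul' := fun _ _ ↦ rfl }
  refine Module.Finite.of_injective ev ?_
  rw [← LinearMap.ker_eq_bot, LinearMap.ker_eq_bot']
  intro α hα
  exact Subtype.ext (eq_zero_of_mem_biInvariantOneForms α.2 fun v ↦
    congrArg (fun L : E →L[ℝ] ℝ ↦ L v) hα)

lemma contDiffOn_readInChart_vectorForm (x₀ : G) :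
    ContDiffOn ℝ ∞ (readInChart x₀ (vectorForm fun i ↦ (b i : OneForm 𝓘(ℝ, E) G)))
      (extChartAt 𝓘(ℝ, E) x₀).target := by
  rw [contDiffOn_clm_apply]
  intro v
  rw [contDiffOn_euclidean]
  intro i
  exact (contDiffOn_readInChart x₀ (b i : OneForm 𝓘(ℝ, E) G)).clm_apply contDiffOn_const

/-- A vector outside the span is detected by a linear form vanishing on the span. That form extends
to a bi-invariant form, hence to a combination of the basis, contradicting `hv`. -/
lemma mem_adjointCommutatorSpan_of_vectorForm_eq_zero {v : E}
    (hv : vectorForm (fun i ↦ (b i : OneForm 𝓘(ℝ, E) G)) 1 v = 0) :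
    v ∈ adjointCommutatorSpan E G := by
  by_contra hcon
  obtain ⟨L, hLv, hL⟩ := Submodule.exists_le_ker_of_notMem hcon
  obtain ⟨α, hα, hα1⟩ := exists_mem_biInvariantOneForms (G := G) (L := LinearMap.toContinuousLinearMap L)
    (by simpa using hL)
  apply hLv
  have h1 := hα1 v
  obtain ⟨l, hl⟩ := exists_eq_comp_vectorForm b ⟨α, hα⟩
  exact h1.symm.trans ((hl 1 v).trans ((congrArg l hv).trans (map_zero l)))

end InvariantForms

/-! ### Near the identity, zeros of the primitive lie in the commutator subgroup. -/

section LocalLeaf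

variable {E : Type*} [NormedAddCommGroup E] [NormedSpace ℝ E]
  {G : Type*} [TopologicalSpace G] [ChartedSpace E G] [Group G]

section

variable {T : Type*} [NormedAddCommGroup T] [NormedSpace ℝ T]

/-- A smooth map through the identity whose derivative at `0` is `A`. -/
def chartPlane (G : Type*) [TopologicalSpace G] [ChartedSpace E G] [Group G] (A : T →L[ℝ] E)
    (t : T) : G :=
  (extChartAt 𝓘(ℝ, E) (1 : G)).symm (extChartAt 𝓘(ℝ, E) (1 : G) 1 + A t)

lemma chartPlane_zero (A : T →L[ℝ] E) : chartPlane G A 0 = 1 := by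
  simp [chartPlane]

variable [IsManifold 𝓘(ℝ, E) ∞ G]

lemma contMDiffAt_chartPlane (A : T →L[ℝ] E) :
    ContMDiffAt 𝓘(ℝ, T) 𝓘(ℝ, E) ∞ (chartPlane G A) 0 := by
  have h1 : ContMDiffAt 𝓘(ℝ, T) 𝓘(ℝ, E) ∞ (fun t ↦ extChartAt 𝓘(ℝ, E) (1 : G) 1 + A t) 0 :=
    (contDiff_const.add A.contDiff).contMDiff.contMDiffAt
  refine ContMDiffAt.comp 0 ?_ h1
  refine (contMDiffOn_extChartAt_symm 1).contMDiffAt ?_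
  simpa using extChartAt_target_mem_nhds (I := 𝓘(ℝ, E)) (1 : G)

lemma mfderiv_chartPlane (A : T →L[ℝ] E) :
    mfderiv 𝓘(ℝ, T) 𝓘(ℝ, E) (chartPlane G A) 0 = A := by
  set c := extChartAt 𝓘(ℝ, E) (1 : G) with hc
  have h1 : HasFDerivAt (fun t ↦ c 1 + A t) A 0 := A.hasFDerivAt.const_add _
  have h0 : c 1 + A 0 = c 1 := by simp
  have h2 : MDifferentiableAt 𝓘(ℝ, E) 𝓘(ℝ, E) c.symm (c 1 + A 0) := by
    rw [h0]
    exact mdifferentiableAt_extChartAt_symm_modelSelf (mem_extChartAt_target 1)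
  have h3 := mfderiv_comp (0 : T) h2 h1.hasMFDerivAt.mdifferentiableAt
  rw [h1.hasMFDerivAt.mfderiv] at h3
  refine Eq.trans h3 ?_
  have h4 : mfderiv 𝓘(ℝ, E) 𝓘(ℝ, E) c.symm (c 1 + A 0) = ContinuousLinearMap.id ℝ E := by
    rw [h0]
    exact mfderiv_extChartAt_symm_modelSelf 1
  rw [h4]
  rfl

lemma fderiv_extChartAt_comp {p : T → G} (hp : MDifferentiableAt 𝓘(ℝ, T) 𝓘(ℝ, E) p 0)
    (h0 : p 0 = 1) :
    fderiv ℝ (extChartAt 𝓘(ℝ, E) (1 : G) ∘ p) 0 = mfderiv 𝓘(ℝ, T) 𝓘(ℝ, E) p 0 := by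
  have h1 : MDifferentiableAt 𝓘(ℝ, E) 𝓘(ℝ, E) (extChartAt 𝓘(ℝ, E) (1 : G)) (p 0) := by
    rw [h0]; exact mdifferentiableAt_extChartAt (mem_chart_source E 1)
  rw [← mfderiv_eq_fderiv, mfderiv_comp (0 : T) h1 hp]
  have h2 : mfderiv 𝓘(ℝ, E) 𝓘(ℝ, E) (extChartAt 𝓘(ℝ, E) (1 : G)) (p 0) =
      ContinuousLinearMap.id ℝ E := by
    rw [h0]; exact mfderiv_extChartAt_self
  rw [h2]
  rfl

end

variable {W : Type*} [NormedAddCommGroup W] {f : G → W}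

/-- The subspace `p` is contained in the image of the derivative of some smooth family of elements
of the commutator subgroup, on which `f` vanishes. -/
def IsReachedByCommutators (f : G → W) (p : Submodule ℝ E) : Prop :=
  ∃ (T : Type) (_ : NormedAddCommGroup T) (_ : NormedSpace ℝ T) (_ : CompleteSpace T) (Φ : T → G),
    ContMDiffAt 𝓘(ℝ, T) 𝓘(ℝ, E) ∞ Φ 0 ∧ Φ 0 = 1 ∧ (∀ t, Φ t ∈ commutator G) ∧
    (∀ᶠ t in 𝓝 0, f (Φ t) = 0) ∧
    ∀ w ∈ p, ∃ t : T, (mfderiv 𝓘(ℝ, T) 𝓘(ℝ, E) Φ 0 t : E) = w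

lemma IsReachedByCommutators.mono {p q : Submodule ℝ E} (hq : IsReachedByCommutators f q)
    (h : p ≤ q) : IsReachedByCommutators f p := by
  obtain ⟨T, i1, i2, i3, Φ, h1, h2, h3, h4, h5⟩ := hq
  exact ⟨T, i1, i2, i3, Φ, h1, h2, h3, h4, fun w hw ↦ h5 w (h hw)⟩

variable [NormedSpace ℝ W] {η : Π x : G, TangentSpace 𝓘(ℝ, E) x →L[ℝ] W}

lemma isReachedByCommutators_bot (hf : IsLocalPrimitive f η) :
    IsReachedByCommutators f (⊥ : Submodule ℝ E) := by
  refine ⟨ℝ, inferInstance, inferInstance, inferInstance, fun _ ↦ 1, contMDiffAt_const, rfl,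
    fun _ ↦ one_mem _, Filter.Eventually.of_forall fun _ ↦ hf.map_one, ?_⟩
  intro w hw
  refine ⟨0, ?_⟩
  rw [(Submodule.mem_bot ℝ).1 hw]
  exact map_zero (mfderiv 𝓘(ℝ, ℝ) 𝓘(ℝ, E) (fun _ : ℝ ↦ (1 : G)) 0)

variable [LieGroup 𝓘(ℝ, E) ∞ G]

section

variable {F : Type*} [NormedAddCommGroup F] [NormedSpace ℝ F]
  {H : Type*} [TopologicalSpace H] {J : ModelWithCorners ℝ F H}
  {M : Type*} [TopologicalSpace M] [ChartedSpace H M]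

lemma mfderiv_groupMul_of_eq_one {p q : M → G} {z : M} (hp : MDifferentiableAt J 𝓘(ℝ, E) p z)
    (hq : MDifferentiableAt J 𝓘(ℝ, E) q z) (hpz : p z = 1) (hqz : q z = 1) (v : TangentSpace J z) :
    mfderiv J 𝓘(ℝ, E) (fun z ↦ p z * q z) z v =
      (fun a b : E ↦ a + b) (mfderiv J 𝓘(ℝ, E) p z v) (mfderiv J 𝓘(ℝ, E) q z v) := by
  rw [mfderiv_groupMul hp hq v]
  have h1 : (fun x : G ↦ x * q z) = id := by funext x; simp [hqz]
  have h2 : (fun x : G ↦ p z * x) = id := by funext x; simp [hpz]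
  rw [h1, h2, mfderiv_id, mfderiv_id]
  rfl

lemma mfderiv_groupInv_of_eq_one {p : M → G} {z : M} (hp : MDifferentiableAt J 𝓘(ℝ, E) p z)
    (hpz : p z = 1) (v : TangentSpace J z) :
    mfderiv J 𝓘(ℝ, E) (fun z ↦ (p z)⁻¹) z v = (-(mfderiv J 𝓘(ℝ, E) p z v : E) : E) := by
  have h1 := mfderiv_groupMul_of_eq_one hp hp.groupInv hpz (by simp [hpz]) v
  have h2 : (fun z ↦ p z * (p z)⁻¹) = fun _ ↦ (1 : G) := by funext x; simp
  rw [h2, mfderiv_const] at h1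
  exact (neg_eq_of_add_eq_zero_right (G := E) h1.symm).symm

lemma mfderiv_conj_of_eq_one {p : M → G} {z : M} (hp : MDifferentiableAt J 𝓘(ℝ, E) p z)
    (hpz : p z = 1) (g : G) (v : TangentSpace J z) :
    mfderiv J 𝓘(ℝ, E) (fun z ↦ g * p z * g⁻¹) z v =
      (adjointMap g (mfderiv J 𝓘(ℝ, E) p z v : E) : E) := by
  have h1 := mfderiv_comp z (mdifferentiableAt_conj (E := E) g (p z)) hp
  refine (congrArg (fun A : F →L[ℝ] E ↦ A v) h1).trans ?_
  have h2 : ∀ y : G, y = 1 → ∀ w : E, (mfderiv 𝓘(ℝ, E) 𝓘(ℝ, E) (fun x : G ↦ g * x * g⁻¹) y w : E) =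
      adjointMap g w := by
    rintro _ rfl w
    rfl
  exact h2 _ hpz _

end

lemma IsLocalPrimitive.eventually_map_inv (hη : IsBiInvariantForm η) (hf : IsLocalPrimitive f η) :
    ∀ᶠ x in 𝓝 (1 : G), f x⁻¹ = -f x := by
  have : IsTopologicalGroup G := topologicalGroup_of_lieGroup 𝓘(ℝ, E) ∞
  have t : Filter.Tendsto (fun x : G ↦ (x, x⁻¹)) (𝓝 1) (𝓝 (1, 1)) := by
    have : Continuous fun x : G ↦ (x, x⁻¹) := by fun_prop
    simpa using this.tendsto 1
  filter_upwards [t.eventually (hf.eventually_map_mul hη)] with x hx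
  rw [mul_inv_cancel, hf.map_one] at hx
  exact (neg_eq_of_add_eq_zero_right hx.symm).symm

/-- Multiply the two families: at `1` the derivative of a product is the sum of the derivatives, and
`f` is additive there. -/
lemma IsReachedByCommutators.sup (hη : IsBiInvariantForm η) (hf : IsLocalPrimitive f η)
    {p q : Submodule ℝ E} (hp : IsReachedByCommutators f p)
    (hq : IsReachedByCommutators f q) : IsReachedByCommutators f (p ⊔ q) := by
  obtain ⟨T, i1, i2, i3, Φ, h1, h2, h3, h4, h5⟩ := hp
  obtain ⟨T', i1', i2', i3', Φ', h1', h2', h3', h4', h5'⟩ := hq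
  have c1 : ContMDiffAt 𝓘(ℝ, T × T') 𝓘(ℝ, E) ∞ (fun t : T × T' ↦ Φ t.1) 0 :=
    ContMDiffAt.comp (0 : T × T') (g := Φ) h1 contDiff_fst.contMDiff.contMDiffAt
  have c2 : ContMDiffAt 𝓘(ℝ, T × T') 𝓘(ℝ, E) ∞ (fun t : T × T' ↦ Φ' t.2) 0 :=
    ContMDiffAt.comp (0 : T × T') (g := Φ') h1' contDiff_snd.contMDiff.contMDiffAt
  have t1 : Filter.Tendsto (fun t : T × T' ↦ t.1) (𝓝 0) (𝓝 0) := continuous_fst.tendsto _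
  have t2 : Filter.Tendsto (fun t : T × T' ↦ t.2) (𝓝 0) (𝓝 0) := continuous_snd.tendsto _
  refine ⟨T × T', inferInstance, inferInstance, inferInstance, fun t ↦ Φ t.1 * Φ' t.2, c1.mul c2,
    by simp [h2, h2'], fun t ↦ mul_mem (h3 _) (h3' _), ?_, ?_⟩
  · have t3 : Filter.Tendsto (fun t : T × T' ↦ (Φ t.1, Φ' t.2)) (𝓝 0) (𝓝 (1, 1)) := by
      have := c1.continuousAt.prodMk_nhds c2.continuousAt
      simpa [h2, h2'] using this
    filter_upwards [t3.eventually (hf.eventually_map_mul hη), t1.eventually h4, t2.eventually h4']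
      with t e1 e2 e3
    rw [e1, e2, e3, add_zero]
  · intro w hw
    obtain ⟨a, ha, b, hb, rfl⟩ := Submodule.mem_sup.1 hw
    obtain ⟨s, rfl⟩ := h5 a ha
    obtain ⟨s', rfl⟩ := h5' b hb
    refine ⟨(s, s'), ?_⟩
    have d1 := c1.mdifferentiableAt (by simp)
    have d2 := c2.mdifferentiableAt (by simp)
    refine (mfderiv_groupMul_of_eq_one d1 d2 h2 h2' _).trans ?_
    have e1 : mfderiv 𝓘(ℝ, T × T') 𝓘(ℝ, E) (fun t : T × T' ↦ Φ t.1) 0 =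
        (mfderiv 𝓘(ℝ, T) 𝓘(ℝ, E) Φ 0).comp (ContinuousLinearMap.fst ℝ T T') := by
      have k1 := mfderiv_comp (0 : T × T') (g := Φ) (f := fun t : T × T' ↦ t.1)
        (h1.mdifferentiableAt (by simp)) hasFDerivAt_fst.hasMFDerivAt.mdifferentiableAt
      refine k1.trans ?_
      rw [mfderiv_eq_fderiv, fderiv_fst]
      rfl
    have e2 : mfderiv 𝓘(ℝ, T × T') 𝓘(ℝ, E) (fun t : T × T' ↦ Φ' t.2) 0 =
        (mfderiv 𝓘(ℝ, T') 𝓘(ℝ, E) Φ' 0).comp (ContinuousLinearMap.snd ℝ T T') := by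
      have k1 := mfderiv_comp (0 : T × T') (g := Φ') (f := fun t : T × T' ↦ t.2)
        (h1'.mdifferentiableAt (by simp)) hasFDerivAt_snd.hasMFDerivAt.mdifferentiableAt
      refine k1.trans ?_
      rw [mfderiv_eq_fderiv, fderiv_snd]
      rfl
    rw [e1, e2]
    rfl

/-- For a curve `p` through `1` with velocity `v`, the commutators `g p(t) g⁻¹ p(t)⁻¹` have velocity
`Ad_g v - v`; conjugation invariance and additivity give `f = 0` along them. -/
lemma isReachedByCommutators_span_singleton (hη : IsBiInvariantForm η)
    (hf : IsLocalPrimitive f η) (g : G) (v : E) :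
    IsReachedByCommutators f (Submodule.span ℝ {(adjointMap g v - v : E)}) := by
  set A : ℝ →L[ℝ] E := ContinuousLinearMap.toSpanSingleton ℝ v with hA
  set p : ℝ → G := chartPlane G A with hp
  have hp0 : p 0 = 1 := chartPlane_zero A
  have hpc : ContMDiffAt 𝓘(ℝ, ℝ) 𝓘(ℝ, E) ∞ p 0 := contMDiffAt_chartPlane A
  have hpd : MDifferentiableAt 𝓘(ℝ, ℝ) 𝓘(ℝ, E) p 0 := hpc.mdifferentiableAt (by simp)
  have hpm : mfderiv 𝓘(ℝ, ℝ) 𝓘(ℝ, E) p 0 = A := mfderiv_chartPlane A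
  have t0 : Filter.Tendsto p (𝓝 0) (𝓝 1) := by
    have := hpc.continuousAt
    rwa [ContinuousAt, hp0] at this
  have hqc : ContMDiffAt 𝓘(ℝ, ℝ) 𝓘(ℝ, E) ∞ (fun t ↦ g * p t * g⁻¹) 0 :=
    (contMDiffAt_const.mul hpc).mul contMDiffAt_const
  have hqd : MDifferentiableAt 𝓘(ℝ, ℝ) 𝓘(ℝ, E) (fun t ↦ g * p t * g⁻¹) 0 :=
    hqc.mdifferentiableAt (by simp)
  refine ⟨ℝ, inferInstance, inferInstance, inferInstance, fun t ↦ g * p t * g⁻¹ * (p t)⁻¹,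
    hqc.mul hpc.inv, by simp [hp0], fun t ↦ ?_, ?_, ?_⟩
  · exact Subgroup.commutator_mem_commutator (Subgroup.mem_top g) (Subgroup.mem_top (p t))
  · have t3 : Filter.Tendsto (fun t ↦ (g * p t * g⁻¹, (p t)⁻¹)) (𝓝 0) (𝓝 (1, 1)) := by
      have := hqc.continuousAt.prodMk_nhds hpc.inv.continuousAt
      simpa [hp0] using this
    filter_upwards [t3.eventually (hf.eventually_map_mul hη),
      t0.eventually (hf.eventually_map_conj hη g), t0.eventually (hf.eventually_map_inv hη)]
      with t e1 e2 e3
    rw [e1, e2, e3, add_neg_cancel]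
  · intro w hw
    obtain ⟨a, rfl⟩ := Submodule.mem_span_singleton.1 hw
    refine ⟨a, ?_⟩
    refine (mfderiv_groupMul_of_eq_one hqd hpd.groupInv (by simp [hp0]) (by simp [hp0]) _).trans ?_
    refine (congrArg₂ (fun a b : E ↦ a + b) (mfderiv_conj_of_eq_one hpd hp0 g _)
      (mfderiv_groupInv_of_eq_one hpd hp0 _)).trans ?_
    rw [hpm]
    have : A a = a • v := by simp [hA]
    change adjointMap g (A a) + -(A a) = _
    rw [this, map_smul, smul_sub, sub_eq_add_neg]

variable [FiniteDimensional ℝ E]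

lemma isReachedByCommutators_adjointCommutatorSpan (hη : IsBiInvariantForm η)
    (hf : IsLocalPrimitive f η) : IsReachedByCommutators f (adjointCommutatorSpan E G) := by
  have h1 : ∀ w ∈ adjointCommutatorSpan E G, IsReachedByCommutators f (Submodule.span ℝ {w}) := by
    intro w hw
    induction hw using Submodule.span_induction with
    | mem x hx =>
      obtain ⟨g, v, rfl⟩ := hx
      exact isReachedByCommutators_span_singleton hη hf g v
    | zero => simpa using isReachedByCommutators_bot hf
    | add x y _ _ hx hy =>
      refine (hx.sup hη hf hy).mono ?_
      rw [Submodule.span_singleton_le_iff_mem]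
      exact add_mem (Submodule.mem_sup_left (Submodule.mem_span_singleton_self x))
        (Submodule.mem_sup_right (Submodule.mem_span_singleton_self y))
    | smul a x _ hx => exact hx.mono (Submodule.span_singleton_smul_le ℝ a x)
  have h2 : ∀ p : Submodule ℝ E, p ≤ adjointCommutatorSpan E G → IsReachedByCommutators f p := by
    intro p
    refine Submodule.fg_induction (motive := fun p _ ↦ p ≤ adjointCommutatorSpan E G →
      IsReachedByCommutators f p) ?_ ?_ p (IsNoetherian.noetherian p)
    · exact fun x h ↦ h1 x ((Submodule.span_singleton_le_iff_mem _ _).1 h)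
    · exact fun p q _ _ hp hq h ↦
        (hp (le_sup_left.trans h)).sup hη hf (hq (le_sup_right.trans h))
  exact h2 _ le_rfl

/-- Near the identity, the zero set of `f` is contained in the commutator subgroup. -/
theorem IsLocalPrimitive.eventually_mem_commutator [CompleteSpace W] (hη : IsBiInvariantForm η)
    (hf : IsLocalPrimitive f η) (hsurj : Function.Surjective (η 1))
    (hker : ∀ v : E, η 1 v = 0 → v ∈ adjointCommutatorSpan E G) :
    ∀ᶠ x in 𝓝 (1 : G), f x = 0 → x ∈ commutator G := by
  obtain ⟨T, i1, i2, i3, Φ, h1, h2, h3, h4, h5⟩ :=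
    isReachedByCommutators_adjointCommutatorSpan hη hf
  set A : E →L[ℝ] W := η 1 with hA
  have : FiniteDimensional ℝ W := FiniteDimensional.of_surjective (A : E →ₗ[ℝ] W) hsurj
  -- A linear section of `η 1` gives a slice `s` transverse to its kernel, on which `f` is a local
  -- coordinate.
  obtain ⟨B₀, hB₀⟩ := (A : E →ₗ[ℝ] W).exists_rightInverse_of_surjective (LinearMap.range_eq_top.2 hsurj)
  set B : W →L[ℝ] E := LinearMap.toContinuousLinearMap B₀ with hB
  have hAB : ∀ w, A (B w) = w := fun w ↦ congrArg (fun L : W →ₗ[ℝ] W ↦ L w) hB₀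
  set s : W → G := chartPlane G B with hs
  have hs0 : s 0 = 1 := chartPlane_zero B
  have hsc : ContMDiffAt 𝓘(ℝ, W) 𝓘(ℝ, E) ∞ s 0 := contMDiffAt_chartPlane B
  have hsd : mfderiv 𝓘(ℝ, W) 𝓘(ℝ, E) s 0 = B := mfderiv_chartPlane B
  -- `f ∘ s` has derivative `1` at `0`
  have hfs : HasFDerivAt (f ∘ s) (ContinuousLinearMap.id ℝ W) 0 := by
    have hf1 := hf.eventually.self_of_nhds
    rw [← hs0] at hf1
    obtain ⟨k1, k2⟩ := hasMFDerivAt_comp_primitive (p := s) (z := (0 : W)) hf1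
      (hsc.mdifferentiableAt (by simp))
    have k3 : HasFDerivAt (f ∘ s) (fderiv ℝ (f ∘ s) 0) 0 :=
      (mdifferentiableAt_iff_differentiableAt.1 k1).hasFDerivAt
    refine k3.congr_fderiv ?_
    ext w
    have k4 := k2 w
    rw [hsd] at k4
    have k5 : ∀ y : G, y = 1 → ∀ v : E, η y v = A v := by
      rintro _ rfl v
      rfl
    have k6 := k4.trans ((k5 _ hs0 (B w)).trans (hAB w))
    rw [← mfderiv_eq_fderiv]
    exact k6
  have hinj : ∀ᶠ u in 𝓝 (0 : W), f (s u) = 0 → u = 0 := by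
    have := hfs.eventually_ne (c := (0 : W)) ⟨1, fun z ↦ by simp⟩
    rw [eventually_nhdsWithin_iff] at this
    filter_upwards [this] with u hu h0
    by_contra hne
    exact hu hne h0
  -- For small parameters `f (Ψ (t, w)) = f (s w)`, so a zero of `f` forces `w = 0` and the point is
  -- `Φ t`, a member of `[G, G]`.
  set Ψ : T × W → G := fun t ↦ Φ t.1 * s t.2 with hΨ
  have c1 : ContMDiffAt 𝓘(ℝ, T × W) 𝓘(ℝ, E) ∞ (fun t : T × W ↦ Φ t.1) 0 :=
    ContMDiffAt.comp (0 : T × W) (g := Φ) h1 contDiff_fst.contMDiff.contMDiffAt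
  have c2 : ContMDiffAt 𝓘(ℝ, T × W) 𝓘(ℝ, E) ∞ (fun t : T × W ↦ s t.2) 0 :=
    ContMDiffAt.comp (0 : T × W) (g := s) hsc contDiff_snd.contMDiff.contMDiffAt
  have cΨ : ContMDiffAt 𝓘(ℝ, T × W) 𝓘(ℝ, E) ∞ Ψ 0 := c1.mul c2
  have hΨ0 : Ψ 0 = 1 := by simp [hΨ, h2, hs0]
  have d1 := c1.mdifferentiableAt (by simp)
  have d2 := c2.mdifferentiableAt (by simp)
  have hder : ∀ t : T × W, (mfderiv 𝓘(ℝ, T × W) 𝓘(ℝ, E) Ψ 0 t : E) =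
      (fun a b : E ↦ a + b) (mfderiv 𝓘(ℝ, T) 𝓘(ℝ, E) Φ 0 t.1) (B t.2) := by
    intro t
    refine (mfderiv_groupMul_of_eq_one d1 d2 h2 hs0 _).trans ?_
    have e1 : mfderiv 𝓘(ℝ, T × W) 𝓘(ℝ, E) (fun t : T × W ↦ Φ t.1) 0 =
        (mfderiv 𝓘(ℝ, T) 𝓘(ℝ, E) Φ 0).comp (ContinuousLinearMap.fst ℝ T W) := by
      have k1 := mfderiv_comp (0 : T × W) (g := Φ) (f := fun t : T × W ↦ t.1)
        (h1.mdifferentiableAt (by simp)) hasFDerivAt_fst.hasMFDerivAt.mdifferentiableAt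
      refine k1.trans ?_
      rw [mfderiv_eq_fderiv, fderiv_fst]
      rfl
    have e2 : mfderiv 𝓘(ℝ, T × W) 𝓘(ℝ, E) (fun t : T × W ↦ s t.2) 0 =
        B.comp (ContinuousLinearMap.snd ℝ T W) := by
      have k1 := mfderiv_comp (0 : T × W) (g := s) (f := fun t : T × W ↦ t.2)
        (hsc.mdifferentiableAt (by simp)) hasFDerivAt_snd.hasMFDerivAt.mdifferentiableAt
      refine k1.trans ?_
      rw [mfderiv_eq_fderiv, fderiv_snd]
      exact congrArg (fun L : W →L[ℝ] E ↦ L.comp (ContinuousLinearMap.snd ℝ T W)) hsd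
    rw [e1, e2]
    rfl
  set c := extChartAt 𝓘(ℝ, E) (1 : G) with hc
  have hcΨ : ContDiffAt ℝ ∞ (c ∘ Ψ) 0 := by
    rw [← contMDiffAt_iff_contDiffAt]
    refine ContMDiffAt.comp 0 ?_ cΨ
    rw [hΨ0]
    exact contMDiffAt_extChartAt
  have hstrict := hcΨ.hasStrictFDerivAt (by simp)
  rw [fderiv_extChartAt_comp (cΨ.mdifferentiableAt (by simp)) hΨ0] at hstrict
  -- Split `e = (e - B (A e)) + B (A e)`: the first summand is in the kernel of `η 1`, reached by
  -- `Φ`, and the second by the slice. Completeness of `T` and `W` permits the open mapping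
  -- argument.
  have hmap := hstrict.map_nhds_eq_of_surj (by
    rw [LinearMap.range_eq_top]
    intro e
    have he : e - B (A e) ∈ adjointCommutatorSpan E G := by
      refine hker _ ?_
      change A (e - B (A e)) = 0
      rw [map_sub, hAB, sub_self]
    obtain ⟨t, ht⟩ := h5 _ he
    refine ⟨(t, A e), (hder _).trans ?_⟩
    change (fun a b : E ↦ a + b) (mfderiv 𝓘(ℝ, T) 𝓘(ℝ, E) Φ 0 t) (B (A e)) = e
    rw [ht]
    simp)
  have hgood : ∀ᶠ t : T × W in 𝓝 0, (f (Ψ t) = 0 → Ψ t ∈ commutator G) ∧ Ψ t ∈ c.source := by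
    have t1 : Filter.Tendsto (fun t : T × W ↦ t.1) (𝓝 0) (𝓝 0) := continuous_fst.tendsto _
    have t2 : Filter.Tendsto (fun t : T × W ↦ t.2) (𝓝 0) (𝓝 0) := continuous_snd.tendsto _
    have t3 : Filter.Tendsto (fun t : T × W ↦ (Φ t.1, s t.2)) (𝓝 0) (𝓝 (1, 1)) := by
      have := c1.continuousAt.prodMk_nhds c2.continuousAt
      simpa [h2, hs0] using this
    have hsrc : ∀ᶠ t : T × W in 𝓝 0, Ψ t ∈ c.source := by
      refine cΨ.continuousAt.eventually_mem ?_
      rw [hΨ0]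
      exact extChartAt_source_mem_nhds 1
    filter_upwards [t3.eventually (hf.eventually_map_mul hη), t1.eventually h4,
      t2.eventually hinj, hsrc] with t e1 e2 e3 e4
    refine ⟨fun h0 ↦ ?_, e4⟩
    have h6 : f (s t.2) = 0 := by
      rw [← h0]
      change _ = f (Φ t.1 * s t.2)
      rw [e1, e2, zero_add]
    change Φ t.1 * s t.2 ∈ commutator G
    rw [e3 h6, hs0, mul_one]
    exact h3 _
  have himage : (c ∘ Ψ) '' {t | (f (Ψ t) = 0 → Ψ t ∈ commutator G) ∧ Ψ t ∈ c.source} ∈ 𝓝 (c 1) := by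
    have := Filter.image_mem_map (m := c ∘ Ψ) hgood
    rw [hmap] at this
    simpa [hΨ0] using this
  filter_upwards [(continuousAt_extChartAt (I := 𝓘(ℝ, E)) (1 : G)).eventually_mem himage,
    extChartAt_source_mem_nhds (I := 𝓘(ℝ, E)) (1 : G)] with x hx hxs
  obtain ⟨t, ⟨ht1, ht2⟩, hte⟩ := hx
  have : Ψ t = x := c.injOn ht2 hxs hte
  rwa [this] at ht1

end LocalLeaf

/-! ### Lie group structure from a chart that is a local homomorphism. -/

section LocallyAdditiveChart

variable {W : Type*} [NormedAddCommGroup W] {A : Type*} [TopologicalSpace A] [Group A]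

/-- A chart of a topological group around `1` which is a local homomorphism. -/
structure IsLocallyAdditiveChart (φ : OpenPartialHomeomorph A W) : Prop where
  one_mem : 1 ∈ φ.source
  map_mul : ∀ x ∈ φ.source, ∀ y ∈ φ.source, x * y ∈ φ.source → φ (x * y) = φ x + φ y

namespace IsLocallyAdditiveChart

variable {φ : OpenPartialHomeomorph A W}

lemma source_mem_nhds (hφ : IsLocallyAdditiveChart φ) : φ.source ∈ 𝓝 1 :=
  φ.open_source.mem_nhds hφ.one_mem

lemma map_one (hφ : IsLocallyAdditiveChart φ) : φ 1 = 0 := by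
  simpa using hφ.map_mul 1 hφ.one_mem 1 hφ.one_mem (by simpa using hφ.one_mem)

variable [IsTopologicalGroup A]

lemma eventually_map_mul_right (hφ : IsLocallyAdditiveChart φ) {x : A} (hx : x ∈ φ.source) :
    ∀ᶠ z in 𝓝 1, φ (x * z) = φ x + φ z := by
  have t : Filter.Tendsto (fun z ↦ x * z) (𝓝 1) (𝓝 x) := by
    simpa using (continuous_const_mul x).tendsto 1
  filter_upwards [hφ.source_mem_nhds, t (φ.open_source.mem_nhds hx)] with z h1 h2
  exact hφ.map_mul x hx z h1 h2

lemma eventually_map_mul (hφ : IsLocallyAdditiveChart φ) :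
    ∀ᶠ p in 𝓝 ((1, 1) : A × A), φ (p.1 * p.2) = φ p.1 + φ p.2 := by
  have t : Filter.Tendsto (fun p : A × A ↦ p.1 * p.2) (𝓝 (1, 1)) (𝓝 1) := by
    simpa using continuous_mul.tendsto ((1, 1) : A × A)
  filter_upwards [prod_mem_nhds hφ.source_mem_nhds hφ.source_mem_nhds, t hφ.source_mem_nhds]
    with p h1 h2
  exact hφ.map_mul _ h1.1 _ h1.2 h2

lemma eventually_map_inv (hφ : IsLocallyAdditiveChart φ) : ∀ᶠ x in 𝓝 1, φ x⁻¹ = -φ x := by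
  have t : Filter.Tendsto (fun x : A ↦ (x, x⁻¹)) (𝓝 1) (𝓝 (1, 1)) := by
    have : Continuous fun x : A ↦ (x, x⁻¹) := by fun_prop
    simpa using this.tendsto 1
  filter_upwards [t.eventually hφ.eventually_map_mul] with x hx
  rw [mul_inv_cancel, hφ.map_one] at hx
  exact (neg_eq_of_add_eq_zero_right hx.symm).symm

end IsLocallyAdditiveChart

variable [IsTopologicalGroup A]

/-- The translate of a chart around `1` to a chart around `a`. -/
def translateChart (φ : OpenPartialHomeomorph A W) (a : A) : OpenPartialHomeomorph A W :=
  (Homeomorph.mulLeft a⁻¹).toOpenPartialHomeomorph.trans φ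

lemma mem_translateChart_source {φ : OpenPartialHomeomorph A W} {a x : A} :
    x ∈ (translateChart φ a).source ↔ a⁻¹ * x ∈ φ.source := by
  simp [translateChart]

lemma translateChart_apply (φ : OpenPartialHomeomorph A W) (a x : A) :
    translateChart φ a x = φ (a⁻¹ * x) := rfl

/-- The charted space structure given by the translates of a chart around `1`. -/
@[reducible]
def IsLocallyAdditiveChart.chartedSpace {φ : OpenPartialHomeomorph A W}
    (hφ : IsLocallyAdditiveChart φ) : ChartedSpace W A where
  atlas := Set.range (translateChart φ)
  chartAt := translateChart φ
  mem_chart_source a := by simpa [mem_translateChart_source] using hφ.one_mem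
  chart_mem_atlas a := Set.mem_range_self a

variable {φ : OpenPartialHomeomorph A W}

/-- Near `x`, each translated chart is a constant plus `φ (x⁻¹ y)`, so two of them differ by a
constant. -/
lemma IsLocallyAdditiveChart.hasTranslationAtlas (hφ : IsLocallyAdditiveChart φ) :
    letI := hφ.chartedSpace
    HasTranslationAtlas W A := by
  let := hφ.chartedSpace
  refine ⟨?_⟩
  rintro _ ⟨a, rfl⟩ _ ⟨b, rfl⟩ x ha hb
  rw [mem_translateChart_source] at ha hb
  have t : Filter.Tendsto (fun y ↦ x⁻¹ * y) (𝓝 x) (𝓝 1) := by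
    simpa using (continuous_const_mul x⁻¹).tendsto x
  filter_upwards [t.eventually (hφ.eventually_map_mul_right ha),
    t.eventually (hφ.eventually_map_mul_right hb)] with y h1 h2
  simp only [mul_assoc, mul_inv_cancel_left] at h1 h2
  simp only [translateChart_apply, h1, h2]
  abel

variable [NormedSpace ℝ W]

/-- By commutativity, multiplication read in the charts at `a`, `b` and `a b` is addition, and
inversion is negation. -/
lemma IsLocallyAdditiveChart.lieGroup (hφ : IsLocallyAdditiveChart φ)
    (hcomm : ∀ a b : A, a * b = b * a) :
    letI := hφ.chartedSpace
    LieGroup 𝓘(ℝ, W) ∞ A := by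
  let := hφ.chartedSpace
  have := hφ.hasTranslationAtlas
  have : IsManifold 𝓘(ℝ, W) ∞ A := HasTranslationAtlas.isManifold W A ∞
  have hchart : ∀ a : A, ContMDiffAt 𝓘(ℝ, W) 𝓘(ℝ, W) ∞ (fun x ↦ φ (a⁻¹ * x)) a :=
    fun a ↦ contMDiffAt_extChartAt
  have hmul : ContMDiff (𝓘(ℝ, W).prod 𝓘(ℝ, W)) 𝓘(ℝ, W) ∞ fun p : A × A ↦ p.1 * p.2 := by
    rintro ⟨a, b⟩
    refine contMDiffAt_iff_target.2 ⟨continuous_mul.continuousAt, ?_⟩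
    have h1 : ContMDiffAt (𝓘(ℝ, W).prod 𝓘(ℝ, W)) 𝓘(ℝ, W) ∞
        (fun p : A × A ↦ φ (a⁻¹ * p.1) + φ (b⁻¹ * p.2)) (a, b) :=
      ((hchart a).comp (a, b) contMDiffAt_fst).add ((hchart b).comp (a, b) contMDiffAt_snd)
    refine h1.congr_of_eventuallyEq ?_
    have t : Filter.Tendsto (fun p : A × A ↦ (a⁻¹ * p.1, b⁻¹ * p.2)) (𝓝 (a, b)) (𝓝 (1, 1)) := by
      have : Continuous fun p : A × A ↦ (a⁻¹ * p.1, b⁻¹ * p.2) := by fun_prop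
      simpa using this.tendsto (a, b)
    filter_upwards [t.eventually hφ.eventually_map_mul] with p hp
    rw [← hp]
    change φ ((a * b)⁻¹ * (p.1 * p.2)) = _
    congr 1
    rw [mul_inv_rev, hcomm b⁻¹, mul_assoc, mul_assoc, ← mul_assoc b⁻¹, hcomm b⁻¹, mul_assoc]
  have hinv : ContMDiff 𝓘(ℝ, W) 𝓘(ℝ, W) ∞ fun x : A ↦ x⁻¹ := by
    intro a
    refine contMDiffAt_iff_target.2 ⟨continuous_inv.continuousAt, ?_⟩
    refine (hchart a).neg.congr_of_eventuallyEq ?_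
    have t : Filter.Tendsto (fun x ↦ a⁻¹ * x) (𝓝 a) (𝓝 1) := by
      simpa using (continuous_const_mul a⁻¹).tendsto a
    filter_upwards [t.eventually hφ.eventually_map_inv] with x hx
    change φ (a⁻¹⁻¹ * x⁻¹) = -φ (a⁻¹ * x)
    rw [← hx, mul_inv_rev, hcomm x⁻¹]
  exact { contMDiff_mul := hmul, contMDiff_inv := hinv }

end LocallyAdditiveChart

/-! ### Descending a local homomorphism to the quotient group. -/

section QuotientChart

variable {W : Type*} [NormedAddCommGroup W]
  {G : Type*} [TopologicalSpace G] [Group G] [IsTopologicalGroup G]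

/-- A local homomorphism from `G` to `W` which is locally open, and whose kernel is near `1` the
normal subgroup `N`, descends to a chart of `G ⧸ N`. -/
theorem exists_isLocallyAdditiveChart (N : Subgroup G) [N.Normal] {f : G → W} {V : Set G}
    (hV : IsOpen V) (h1 : 1 ∈ V)
    (hadd : ∀ x ∈ V, ∀ y ∈ V, f (x * y) = f x + f y) (hopen : Filter.map f (𝓝 1) = 𝓝 0)
    (hN : ∀ᶠ x in 𝓝 1, f x = 0 ↔ x ∈ N) :
    ∃ φ : OpenPartialHomeomorph (G ⧸ N) W, IsLocallyAdditiveChart φ ∧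
      ∀ᶠ x : G in 𝓝 1, φ (x : G ⧸ N) = f x := by
  set pr : G → G ⧸ N := QuotientGroup.mk with hp
  have hpm : ∀ x y, pr (x * y) = pr x * pr y := fun _ _ ↦ rfl
  have hV' : ∀ᶠ x in 𝓝 (1 : G), x ∈ V ∧ (f x = 0 ↔ x ∈ N) := Filter.Eventually.and (hV.mem_nhds h1) hN
  have t : Filter.Tendsto (fun p : G × G × G ↦ p.1⁻¹ * (p.2.1 * p.2.2)) (𝓝 (1, 1, 1)) (𝓝 1) := by
    have : Continuous fun p : G × G × G ↦ p.1⁻¹ * (p.2.1 * p.2.2) := by fun_prop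
    simpa using this.tendsto (1, 1, 1)
  -- Three factors are controlled, not two: additivity of the chart compares a representative of a
  -- product with the product of two representatives.
  obtain ⟨S, hSo, h1S, hSV, hS⟩ : ∃ S : Set G, IsOpen S ∧ 1 ∈ S ∧ S ⊆ V ∧
      ∀ x ∈ S, ∀ y ∈ S, ∀ z ∈ S, x⁻¹ * (y * z) ∈ V ∧
        (f (x⁻¹ * (y * z)) = 0 ↔ x⁻¹ * (y * z) ∈ N) := by
    have h := t.eventually hV'
    rw [nhds_prod_eq, nhds_prod_eq, Filter.eventually_prod_iff] at h
    obtain ⟨p, hp, q, hq, hpq⟩ := h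
    rw [Filter.eventually_prod_iff] at hq
    obtain ⟨q₁, hq₁, q₂, hq₂, hq⟩ := hq
    obtain ⟨S, hS, hSo, h1S⟩ := eventually_nhds_iff.1
      ((hp.and (hq₁.and hq₂)).and (hV.mem_nhds h1))
    exact ⟨S, hSo, h1S, fun x hx ↦ (hS x hx).2, fun x hx y hy z hz ↦
      hpq (hS x hx).1.1 (hq (hS y hy).1.2.1 (hS z hz).1.2.2)⟩
  have key : ∀ x ∈ S, ∀ y ∈ S, ∀ z ∈ S, f (y * z) = f x ↔ pr (y * z) = pr x := by
    intro x hx y hy z hz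
    obtain ⟨k1, k2⟩ := hS x hx y hy z hz
    have k3 := hadd x (hSV hx) _ k1
    rw [mul_inv_cancel_left] at k3
    rw [k3, add_eq_left, k2, eq_comm (a := pr (y * z))]
    exact QuotientGroup.eq.symm
  have key' : ∀ x ∈ S, ∀ y ∈ S, f y = f x ↔ pr y = pr x := fun x hx y hy ↦ by
    simpa using key x hx y hy 1 h1S
  set F : G ⧸ N → W := fun q ↦ f (Function.invFunOn pr S q) with hF
  have hFp : ∀ x ∈ S, F (pr x) = f x := by
    intro x hx
    have h : ∃ a ∈ S, pr a = pr x := ⟨x, hx, rfl⟩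
    exact (key' x hx _ (Function.invFunOn_mem h)).2 (Function.invFunOn_eq h)
  have hnhds : ∀ x : G, 𝓝 (pr x) = Filter.map pr (𝓝 x) := fun x ↦ QuotientGroup.nhds_eq N x
  have hFev : ∀ x ∈ S, F ∘ pr =ᶠ[𝓝 x] f := fun x hx ↦ by
    filter_upwards [hSo.mem_nhds hx] with y hy
    exact hFp y hy
  -- Additivity transports `hopen` from `1` to every point of `S`; this one equality gives both
  -- continuity and openness of `F`.
  have hmap : ∀ x ∈ S, Filter.map F (𝓝 (pr x)) = 𝓝 (F (pr x)) := by
    intro x hx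
    rw [hnhds, Filter.map_map, Filter.map_congr (hFev x hx), hFp x hx, ← map_mul_left_nhds_one x,
      Filter.map_map]
    have h2 : f ∘ (fun y ↦ x * y) =ᶠ[𝓝 1] (fun w ↦ f x + w) ∘ f := by
      filter_upwards [hV.mem_nhds h1] with y hy
      exact hadd x (hSV hx) y hy
    rw [Filter.map_congr h2, ← Filter.map_map, hopen, map_add_left_nhds_zero]
  have hso : IsOpen (pr '' S) := QuotientGroup.isOpenMap_coe _ hSo
  have hinj : Set.InjOn F (pr '' S) := by
    rintro _ ⟨x, hx, rfl⟩ _ ⟨y, hy, rfl⟩ h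
    rw [hFp x hx, hFp y hy] at h
    exact (key' y hy x hx).1 h
  have hcont : ContinuousOn F (pr '' S) := by
    rintro _ ⟨x, hx, rfl⟩
    exact ContinuousAt.continuousWithinAt (hmap x hx).le
  have hop : IsOpenMap ((pr '' S).domRestrict F) := by
    refine isOpenMap_iff_nhds_le.2 ?_
    rintro ⟨_, ⟨x, hx, rfl⟩⟩
    have hx' : pr x ∈ pr '' S := ⟨x, hx, rfl⟩
    have : Filter.map ((pr '' S).domRestrict F) (𝓝 ⟨pr x, hx'⟩) =
        Filter.map F (Filter.map Subtype.val (𝓝 (⟨pr x, hx'⟩ : pr '' S))) := by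
      rw [Filter.map_map]; rfl
    rw [map_nhds_subtype_coe_eq_nhds hx' (hso.mem_nhds hx'), hmap x hx] at this
    exact this.ge
  refine ⟨OpenPartialHomeomorph.ofContinuousOpenRestrict (hinj.toPartialEquiv F (pr '' S)) hcont hop
    hso, ⟨⟨1, h1S, rfl⟩, ?_⟩, ?_⟩
  · rintro _ ⟨x, hx, rfl⟩ _ ⟨y, hy, rfl⟩ ⟨z, hz, hxy⟩
    change F (pr x * pr y) = F (pr x) + F (pr y)
    rw [← hpm] at hxy ⊢
    rw [hFp x hx, hFp y hy, ← hxy, hFp z hz, ← hadd x (hSV hx) y (hSV hy)]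
    exact ((key z hz x hx y hy).2 hxy.symm).symm
  · filter_upwards [hSo.mem_nhds h1S] with x hx
    exact hFp x hx

end QuotientChart

/-! ### Submersivity of the primitive, and the derivative of the projection. -/

section

variable {E : Type*} [NormedAddCommGroup E] [NormedSpace ℝ E]
  {G : Type*} [TopologicalSpace G] [ChartedSpace E G] [Group G]
  {W : Type*} [NormedAddCommGroup W] [NormedSpace ℝ W]
  {η : Π x : G, TangentSpace 𝓘(ℝ, E) x →L[ℝ] W}

lemma IsBiInvariantForm.apply_mulInvariantVectorField (hη : IsBiInvariantForm η)
    (v : GroupLieAlgebra 𝓘(ℝ, E) G) (h : G) : η h (mulInvariantVectorField v h) = η 1 v := by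
  refine Eq.trans ?_ (hη.left h 1 v)
  have : ∀ y : G, y = h → η h (mulInvariantVectorField v h) = η y (mulInvariantVectorField v h : E) := by
    rintro _ rfl
    rfl
  exact this _ (mul_one h)

lemma IsBiInvariantForm.surjective (hη : IsBiInvariantForm η) (hs : Function.Surjective (η 1))
    (g : G) : Function.Surjective (η g) := fun w ↦ by
  obtain ⟨v, rfl⟩ := hs w
  exact ⟨_, hη.apply_mulInvariantVectorField v g⟩

variable [LieGroup 𝓘(ℝ, E) ∞ G]

lemma IsBiInvariantForm.apply_leftExtension (hη : IsBiInvariantForm η) (g h : G)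
    (v : TangentSpace 𝓘(ℝ, E) g) : η h (leftExtension g v h) = η g v := by
  have h1 := hη.apply_mulInvariantVectorField (mfderiv 𝓘(ℝ, E) 𝓘(ℝ, E) (fun x : G ↦ g⁻¹ * x) g v : E)
  have h2 := h1 g
  change η g (leftExtension g v g) = _ at h2
  rw [leftExtension_self] at h2
  exact (h1 h).trans h2.symm

/-- The derivative of `f` at `1` is the surjective map `η 1`, so `f` is open there. -/
lemma IsLocalPrimitive.map_nhds_one {f : G → W} [CompleteSpace E] [FiniteDimensional ℝ W]
    (hf : IsLocalPrimitive f η)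
    (hs : Function.Surjective (η 1)) : Filter.map f (𝓝 1) = 𝓝 0 := by
  set c := extChartAt 𝓘(ℝ, E) (1 : G) with hc
  obtain ⟨h1, h2⟩ := hf.eventually.self_of_nhds
  have hc1 : c.symm (c 1) = 1 := extChartAt_to_inv 1
  have hsymm : ContMDiffAt 𝓘(ℝ, E) 𝓘(ℝ, E) ∞ c.symm (c 1) :=
    (contMDiffOn_extChartAt_symm 1).contMDiffAt (extChartAt_target_mem_nhds (I := 𝓘(ℝ, E)) (1 : G))
  have h3 : ContDiffAt ℝ ∞ (f ∘ c.symm) (c 1) := by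
    rw [← contMDiffAt_iff_contDiffAt]
    refine ContMDiffAt.comp (c 1) ?_ hsymm
    rwa [hc1]
  have h4 : ∀ v, fderiv ℝ (f ∘ c.symm) (c 1) v = η 1 v := by
    intro v
    have hf1 := hf.eventually.self_of_nhds
    rw [← hc1] at hf1
    obtain ⟨-, k2⟩ := hasMFDerivAt_comp_primitive (p := c.symm) (z := c 1) hf1
      (hsymm.mdifferentiableAt (by simp))
    rw [← mfderiv_eq_fderiv]
    refine (k2 v).trans ?_
    have k3 : mfderiv 𝓘(ℝ, E) 𝓘(ℝ, E) c.symm (c 1) = ContinuousLinearMap.id ℝ E :=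
      mfderiv_extChartAt_symm_modelSelf 1
    rw [k3]
    have k5 : ∀ y : G, y = 1 → ∀ v : E, (η y v : W) = η 1 v := by
      rintro _ rfl v
      rfl
    exact k5 _ hc1 v
  have h5 := (h3.hasStrictFDerivAt (by simp)).map_nhds_eq_of_surj (by
    rw [LinearMap.range_eq_top]
    intro w
    obtain ⟨v, hv⟩ := hs w
    exact ⟨v, (h4 v).trans hv⟩)
  rw [← hf.map_one, ← hc1]
  change _ = 𝓝 ((f ∘ c.symm) (c 1))
  rw [← h5, ← Filter.map_map, hc1]
  congr 1
  rw [← map_extChartAt_nhds_of_boundaryless (I := 𝓘(ℝ, E)) (1 : G), Filter.map_map]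
  symm
  refine (Filter.map_congr ?_).trans Filter.map_id
  filter_upwards [extChartAt_source_mem_nhds (I := 𝓘(ℝ, E)) (1 : G)] with x hx
  exact c.left_inv hx

end

section

variable {E : Type*} [NormedAddCommGroup E] [NormedSpace ℝ E]
  {G : Type*} [TopologicalSpace G] [ChartedSpace E G] [Group G] [LieGroup 𝓘(ℝ, E) ∞ G]
  {W : Type*} [NormedAddCommGroup W] [NormedSpace ℝ W]
  {η : Π x : G, TangentSpace 𝓘(ℝ, E) x →L[ℝ] W} {f : G → W}
  {A : Type*} [TopologicalSpace A] [Group A] [IsTopologicalGroup A]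
  {φ : OpenPartialHomeomorph A W}

/-- A homomorphism of `G` to a group with a locally additive chart is smooth, with derivative `η`,
if it is given by a primitive of `η` near the identity. -/
lemma IsLocallyAdditiveChart.contMDiff_of_isLocalPrimitive (hφ : IsLocallyAdditiveChart φ)
    (hη : IsBiInvariantForm η) (hf : IsLocalPrimitive f η) (p : G →* A) (hp : Continuous p)
    (h : ∀ᶠ x in 𝓝 1, φ (p x) = f x) :
    letI := hφ.chartedSpace
    ContMDiff 𝓘(ℝ, E) 𝓘(ℝ, W) ∞ p ∧ ∀ x v, (mfderiv 𝓘(ℝ, E) 𝓘(ℝ, W) p x v : W) = η x v := by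
  let := hφ.chartedSpace
  have := hφ.hasTranslationAtlas
  have : IsManifold 𝓘(ℝ, W) ∞ A := HasTranslationAtlas.isManifold W A ∞
  have : IsManifold 𝓘(ℝ, W) 1 A := HasTranslationAtlas.isManifold W A 1
  have : IsTopologicalGroup G := topologicalGroup_of_lieGroup 𝓘(ℝ, E) ∞
  -- In the translated chart at `p x` the homomorphism is `f` after left translation by `x⁻¹`, so
  -- everything follows from the situation at `1`.
  have key : ∀ x : G, (extChartAt 𝓘(ℝ, W) (p x) ∘ p) =ᶠ[𝓝 x] fun y ↦ f (x⁻¹ * y) := by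
    intro x
    have t : Filter.Tendsto (fun y ↦ x⁻¹ * y) (𝓝 x) (𝓝 1) := by
      simpa using (continuous_const_mul x⁻¹).tendsto x
    filter_upwards [t.eventually h] with y hy
    have e : p (x⁻¹ * y) = (p x)⁻¹ * p y := by rw [p.map_mul, p.map_inv]
    rw [← hy, e]
    rfl
  have hf1 : ∀ x : G, ContMDiffAt 𝓘(ℝ, E) 𝓘(ℝ, W) ∞ f (x⁻¹ * x) ∧
      ∀ v, mvfderiv 𝓘(ℝ, E) f (x⁻¹ * x) v = η (x⁻¹ * x) v := fun x ↦ by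
    rw [inv_mul_cancel]
    exact hf.eventually.self_of_nhds
  have hsm : ContMDiff 𝓘(ℝ, E) 𝓘(ℝ, W) ∞ p := by
    intro x
    refine contMDiffAt_iff_target.2 ⟨hp.continuousAt, ?_⟩
    refine ContMDiffAt.congr_of_eventuallyEq ?_ (key x)
    exact ContMDiffAt.comp x (hf1 x).1 contMDiff_mul_left.contMDiffAt
  refine ⟨hsm, fun x v ↦ ?_⟩
  have h1 := mfderiv_comp x
    (mdifferentiableAt_extChartAt (I := 𝓘(ℝ, W)) (mem_chart_source W (p x)))
    ((hsm x).mdifferentiableAt (by simp))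
  rw [(key x).mfderiv_eq] at h1
  have h2 : mfderiv 𝓘(ℝ, W) 𝓘(ℝ, W) (extChartAt 𝓘(ℝ, W) (p x)) (p x) = ContinuousLinearMap.id ℝ W :=
    mfderiv_extChartAt_self
  rw [h2] at h1
  have h3 := congrArg (fun L : E →L[ℝ] W ↦ L v) h1
  refine Eq.trans h3.symm ?_
  exact ((hasMFDerivAt_comp_primitive (hf1 x) (mdifferentiableAt_mul_left_const x⁻¹ x)).2 v).trans
    (hη.left x⁻¹ x v)

end

/-! ### Projection of the canonical connection. -/

section

variable {E : Type*} [NormedAddCommGroup E] [NormedSpace ℝ E] [FiniteDimensional ℝ E]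
  {G : Type*} [TopologicalSpace G] [ChartedSpace E G] [Group G] [LieGroup 𝓘(ℝ, E) ∞ G]
  {W : Type*} [NormedAddCommGroup W] [NormedSpace ℝ W]
  {η : Π x : G, TangentSpace 𝓘(ℝ, E) x →L[ℝ] W}
  {A : Type*} [TopologicalSpace A] [ChartedSpace W A] [HasTranslationAtlas W A]
  [IsManifold 𝓘(ℝ, W) 1 A] [IsManifold 𝓘(ℝ, W) ∞ A]

/-- The canonical connection projects along maps whose derivative is a bi-invariant form. -/
lemma IsBiInvariantForm.projectsTo_translationConnection (hη : IsBiInvariantForm η) {p : G → A}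
    (hp : ContMDiff 𝓘(ℝ, E) 𝓘(ℝ, W) ∞ p)
    (hd : ∀ x v, (mfderiv 𝓘(ℝ, E) 𝓘(ℝ, W) p x v : W) = η x v) :
    ProjectsTo p (canonicalConnection 𝓘(ℝ, E) G) (translationConnection W A) := by
  intro X Y X' Y' hX hY hX' hY' rX rY g
  have : IsManifold 𝓘(ℝ, E) 2 G := .of_le (n := ∞) (by norm_cast)
  set F : G → W := extChartAt 𝓘(ℝ, W) (p g) ∘ p with hF
  have hFs : ContMDiffAt 𝓘(ℝ, E) 𝓘(ℝ, W) 2 F g :=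
    (ContMDiffAt.comp g contMDiffAt_extChartAt (hp g)).of_le (by norm_cast)
  have hFd : ∀ᶠ y in 𝓝 g, ∀ v, mvfderiv 𝓘(ℝ, E) F y v = η y v := by
    filter_upwards [hp.continuous.continuousAt.eventually_mem
      ((chartAt W (p g)).open_source.mem_nhds (mem_chart_source W (p g)))] with y hy v
    have h1 := mfderiv_comp y (mdifferentiableAt_extChartAt (I := 𝓘(ℝ, W)) hy)
      ((hp y).mdifferentiableAt (by simp))
    rw [HasTranslationAtlas.mfderiv_extChartAt hy] at h1
    exact (congrArg (fun L : E →L[ℝ] W ↦ L v) h1).trans (hd y v)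
  have hdF : ∀ v, (mfderiv 𝓘(ℝ, E) 𝓘(ℝ, W) p g v : W) = mvfderiv 𝓘(ℝ, E) F g v :=
    fun v ↦ (hd g v).trans (hFd.self_of_nhds v).symm
  -- A bi-invariant form is constant on left-invariant fields. Consequently `η` kills their
  -- brackets, and its value on `[X, Y]` with `X` left-invariant is `X (η Y)`.
  have hleft : ∀ v w : TangentSpace 𝓘(ℝ, E) g,
      mvfderiv 𝓘(ℝ, E) (fun y ↦ mvfderiv 𝓘(ℝ, E) F y (leftExtension g v y)) g w = 0 := by
    intro v w
    have : (fun y ↦ mvfderiv 𝓘(ℝ, E) F y (leftExtension g v y)) =ᶠ[𝓝 g] fun _ ↦ η g v := by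
      filter_upwards [hFd] with y hy
      rw [hy, hη.apply_leftExtension]
    rw [mvfderiv, this.mfderiv_eq, mfderiv_const]
    rfl
  have hXe := leftExtension_mdifferentiableAt (I := 𝓘(ℝ, E)) g (X g) g
  have b1 := mvfderiv_mlieBracket hFs hXe ((hY g).mdifferentiableAt (by simp))
  have b2 := mvfderiv_mlieBracket hFs hXe (leftExtension_mdifferentiableAt (I := 𝓘(ℝ, E)) g (Y g) g)
  rw [hleft, leftExtension_self, sub_zero] at b1
  rw [hleft, hleft, sub_zero] at b2
  refine (hdF _).trans ?_
  have hcan : canonicalConnection 𝓘(ℝ, E) G Y g (X g) =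
      mlieBracket 𝓘(ℝ, E) (leftExtension g (X g)) Y g -
      (1 / 2 : ℝ) • mlieBracket 𝓘(ℝ, E) (leftExtension g (X g)) (leftExtension g (Y g)) g := rfl
  change _ = mvfderiv 𝓘(ℝ, W) (fun z ↦ (Y' z : W)) (p g) (X' (p g))
  refine (congrArg (mvfderiv 𝓘(ℝ, E) F g) hcan).trans ?_
  rw [map_sub, map_smul, b1, b2, smul_zero, sub_zero]
  have hYY : (fun y ↦ mvfderiv 𝓘(ℝ, E) F y (Y y)) =ᶠ[𝓝 g] (fun z ↦ (Y' z : W)) ∘ p := by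
    filter_upwards [hFd] with y hy
    rw [hy]
    exact (hd y _).symm.trans (rY y)
  have hY's : MDifferentiableAt 𝓘(ℝ, W) 𝓘(ℝ, W) (fun z ↦ (Y' z : W)) (p g) :=
    (contMDiffAt_vectorField_iff.1 (hY' (p g))).mdifferentiableAt (by simp)
  rw [mvfderiv, hYY.mfderiv_eq, mfderiv_comp g hY's ((hp g).mdifferentiableAt (by simp)), ← rX g]
  rfl

end

/-! ### Induced one-forms and flat coordinates on the quotient. -/

section

variable {E : Type*} [NormedAddCommGroup E] [NormedSpace ℝ E]
  {G : Type*} [TopologicalSpace G] [ChartedSpace E G] [Group G] [LieGroup 𝓘(ℝ, E) ∞ G]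
  {m : ℕ} {b : Module.Basis (Fin m) ℝ (biInvariantOneForms 𝓘(ℝ, E) G)}

variable {A : Type*} [TopologicalSpace A] [ChartedSpace (EuclideanSpace ℝ (Fin m)) A]
  [HasTranslationAtlas (EuclideanSpace ℝ (Fin m)) A]
  [IsManifold (𝓡 m) ∞ A] {p : G → A}

/-- A linear combination `l` of the components of `dp` is the pullback of the constant form `l`;
uniqueness is surjectivity of `p` and of its derivative. -/
lemma existsUnique_isPullback (hp : Function.Surjective p)
    (hs : ∀ g, Function.Surjective (mfderiv 𝓘(ℝ, E) (𝓡 m) p g))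
    (hd : ∀ x v, (mfderiv 𝓘(ℝ, E) (𝓡 m) p x v : EuclideanSpace ℝ (Fin m)) =
      vectorForm (fun i ↦ (b i : OneForm 𝓘(ℝ, E) G)) x v)
    {α : OneForm 𝓘(ℝ, E) G} (hα : α ∈ biInvariantOneForms 𝓘(ℝ, E) G) :
    ∃! β : OneForm (𝓡 m) A, IsPullback p β α := by
  obtain ⟨l, hl⟩ := exists_eq_comp_vectorForm b ⟨α, hα⟩
  refine ⟨⟨fun _ ↦ l, fun a ↦ contMDiffAt_dual_section (A := fun _ ↦ l) contMDiffAt_const⟩, ?_, ?_⟩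
  · intro x v
    exact (hl x v).trans (congrArg l (hd x v)).symm
  · intro β hβ
    ext a w
    obtain ⟨x, rfl⟩ := hp a
    obtain ⟨v, rfl⟩ := hs x w
    exact (hβ x v).symm.trans ((hl x v).trans (congrArg l (hd x v)).symm)

lemma isFlatCoordinateSystem_of_isPullback [IsManifold (𝓡 m) 1 A]
    (hp : Function.Surjective p)
    (hs : ∀ g, Function.Surjective (mfderiv 𝓘(ℝ, E) (𝓡 m) p g))
    (hd : ∀ x v, (mfderiv 𝓘(ℝ, E) (𝓡 m) p x v : EuclideanSpace ℝ (Fin m)) =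
      vectorForm (fun i ↦ (b i : OneForm 𝓘(ℝ, E) G)) x v)
    {k : ℕ} (b' : Module.Basis (Fin k) ℝ (biInvariantOneForms 𝓘(ℝ, E) G))
    {θ : Fin k → OneForm (𝓡 m) A}
    (hθ : ∀ i, IsPullback p (θ i) (b' i : OneForm 𝓘(ℝ, E) G)) :
    IsFlatCoordinateSystem (translationConnection (EuclideanSpace ℝ (Fin m)) A) θ := by
  choose l hl using fun i ↦ exists_eq_comp_vectorForm b (b' i)
  let L : EuclideanSpace ℝ (Fin m) →L[ℝ] EuclideanSpace ℝ (Fin k) :=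
    ((PiLp.continuousLinearEquiv 2 ℝ (fun _ : Fin k ↦ ℝ)).symm :
      (Fin k → ℝ) →L[ℝ] EuclideanSpace ℝ (Fin k)).comp (ContinuousLinearMap.pi l)
  have hL : ∀ w i, L w i = l i w := fun _ _ ↦ rfl
  -- `L` is the change of basis from `b` to `b'`. It is onto because the `b'`-form at `1` is onto
  -- and factors through it, hence bijective as both bases have the same size.
  have hsurj : Function.Surjective L := by
    intro u
    obtain ⟨v, rfl⟩ := surjective_vectorForm_one b' u
    refine ⟨vectorForm (fun i ↦ (b i : OneForm 𝓘(ℝ, E) G)) 1 v, ?_⟩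
    ext i
    exact (hl i 1 v).symm
  have hk : m = k := by
    have h1 := Module.finrank_eq_card_basis b
    have h2 := Module.finrank_eq_card_basis b'
    simp only [Fintype.card_fin] at h1 h2
    exact h1.symm.trans h2
  have hinj : Function.Injective (L : EuclideanSpace ℝ (Fin m) →ₗ[ℝ] EuclideanSpace ℝ (Fin k)) :=
    (LinearMap.injective_iff_surjective_of_finrank_eq_finrank (by simp [hk])).2 hsurj
  let e : EuclideanSpace ℝ (Fin m) ≃L[ℝ] EuclideanSpace ℝ (Fin k) :=
    (LinearEquiv.ofBijective (L : EuclideanSpace ℝ (Fin m) →ₗ[ℝ] EuclideanSpace ℝ (Fin k))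
      ⟨hinj, hsurj⟩).toContinuousLinearEquiv
  refine isFlatCoordinateSystem_translationConnection e θ fun i a w ↦ ?_
  obtain ⟨x, rfl⟩ := hp a
  obtain ⟨v, rfl⟩ := hs x w
  exact (hθ i x v).symm.trans ((hl i x v).trans (congrArg (l i) (hd x v)).symm)

end

/-! ### The chart of the abelianization and the main theorem. -/

section

variable {E : Type*} [NormedAddCommGroup E] [NormedSpace ℝ E] [FiniteDimensional ℝ E]
  {G : Type*} [TopologicalSpace G] [T2Space G] [SecondCountableTopology G]
  [ChartedSpace E G] [Group G] [LieGroup 𝓘(ℝ, E) ∞ G]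

/-- If the commutator subgroup is closed, the primitives of a basis of the bi-invariant one-forms
descend to a chart of the abelianization. -/
theorem exists_isLocallyAdditiveChart_vectorForm (hclosed : IsClosed (commutator G : Set G))
    {m : ℕ} (b : Module.Basis (Fin m) ℝ (biInvariantOneForms 𝓘(ℝ, E) G)) :
    ∃ (f : G → EuclideanSpace ℝ (Fin m))
      (φ : OpenPartialHomeomorph (G ⧸ commutator G) (EuclideanSpace ℝ (Fin m))),
      IsLocalPrimitive f (vectorForm fun i ↦ (b i : OneForm 𝓘(ℝ, E) G)) ∧
      IsLocallyAdditiveChart φ ∧ ∀ᶠ x : G in 𝓝 1, φ (x : G ⧸ commutator G) = f x := by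
  have hη := isBiInvariantForm_vectorForm b
  obtain ⟨f, hf⟩ := hη.exists_isLocalPrimitive (contDiffOn_readInChart_vectorForm b 1)
  have : IsTopologicalGroup G := topologicalGroup_of_lieGroup 𝓘(ℝ, E) ∞
  have : LocallyCompactSpace G := Manifold.locallyCompact_of_finiteDimensional 𝓘(ℝ, E)
  have : LocallyConnectedSpace G := ChartedSpace.locallyConnectedSpace E G
  have hadd := hf.eventually_map_mul hη
  rw [nhds_prod_eq, Filter.eventually_prod_self_iff'] at hadd
  obtain ⟨U, hU, hadd⟩ := hadd
  -- Connectedness of `V` is what the countability argument needs.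
  obtain ⟨V, hVU, hVo, h1V, hVc⟩ := locallyConnectedSpace_iff_subsets_isOpen_isConnected.1 this 1 _
    (Filter.inter_mem hU hf.eventually)
  have hcont : ContinuousOn f V := fun x hx ↦
    (hVU hx).2.1.continuousAt.continuousWithinAt
  have haddV : ∀ x ∈ V, ∀ y ∈ V, f (x * y) = f x + f y := fun x hx y hy ↦
    hadd x (hVU hx).1 y (hVU hy).1
  have hzero := eventually_eq_zero_of_mem_commutator hclosed hVc.isPreconnected h1V hVo hcont haddV
    (hf.eventually_map_conj hη)
  have hmem := hf.eventually_mem_commutator hη (surjective_vectorForm_one b)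
    fun v hv ↦ mem_adjointCommutatorSpan_of_vectorForm_eq_zero b hv
  obtain ⟨φ, hφ, h⟩ := exists_isLocallyAdditiveChart (commutator G) hVo h1V haddV
    (hf.map_nhds_one (surjective_vectorForm_one b))
    (hzero.and hmem |>.mono fun x hx ↦ ⟨hx.2, hx.1⟩)
  exact ⟨f, φ, hf, hφ, h⟩

end

end

theorem proposition2p8
    {E : Type*} [NormedAddCommGroup E] [NormedSpace ℝ E] [FiniteDimensional ℝ E]
    {G : Type*} [TopologicalSpace G] [T2Space G] [SecondCountableTopology G]
    [ChartedSpace E G] [Group G] [LieGroup 𝓘(ℝ, E) ∞ G]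
    (hclosed : IsClosed (commutator G : Set G)) :
    ∃ (m : ℕ) (_ : ChartedSpace (EuclideanSpace ℝ (Fin m)) (G ⧸ commutator G))
      (_ : LieGroup (𝓡 m) ∞ (G ⧸ commutator G)),
      -- `G ⧸ [G, G]` carries the quotient manifold structure: the projection is a smooth submersion
      ContMDiff 𝓘(ℝ, E) (𝓡 m) ∞ (QuotientGroup.mk : G → G ⧸ commutator G) ∧
      (∀ g : G, Function.Surjective
        (mfderiv 𝓘(ℝ, E) (𝓡 m) (QuotientGroup.mk : G → G ⧸ commutator G) g)) ∧
      -- every bi-invariant one-form projects to a unique one-form on the quotient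
      (∀ α ∈ biInvariantOneForms 𝓘(ℝ, E) G, ∃! β : OneForm (𝓡 m) (G ⧸ commutator G),
        IsPullback (QuotientGroup.mk : G → G ⧸ commutator G) β α) ∧
      -- the canonical connection projects to a smooth flat connection
      ∃ cov : CovariantDerivative (𝓡 m) (EuclideanSpace ℝ (Fin m))
          (TangentSpace (𝓡 m) : G ⧸ commutator G → Type _),
        CovariantDerivative.ContMDiffCovariantDerivative cov ∞ ∧
        ProjectsTo (QuotientGroup.mk : G → G ⧸ commutator G)
          (canonicalConnection 𝓘(ℝ, E) G) cov ∧
        IsFlatConnection cov ∧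
        -- the one-forms induced by a basis of the bi-invariant ones form flat coordinates
        ∀ (k : ℕ) (b : Module.Basis (Fin k) ℝ (biInvariantOneForms 𝓘(ℝ, E) G))
          (θ : Fin k → OneForm (𝓡 m) (G ⧸ commutator G)),
          (∀ i, IsPullback (QuotientGroup.mk : G → G ⧸ commutator G) (θ i)
            (b i : OneForm 𝓘(ℝ, E) G)) →
          IsFlatCoordinateSystem cov θ := by
  have : IsTopologicalGroup G := topologicalGroup_of_lieGroup 𝓘(ℝ, E) ∞
  -- This basis only builds the atlas; the arbitrary basis of the last clause is reached by a linear
  -- change of coordinates.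
  set b := Module.finBasis ℝ (biInvariantOneForms 𝓘(ℝ, E) G)
  set m := Module.finrank ℝ (biInvariantOneForms 𝓘(ℝ, E) G)
  obtain ⟨f, φ, hf, hφ, h⟩ := exists_isLocallyAdditiveChart_vectorForm hclosed b
  have hη := isBiInvariantForm_vectorForm b
  -- The quotient is by definition `Abelianization G`.
  have hcomm : ∀ x y : G ⧸ commutator G, x * y = y * x := mul_comm (G := Abelianization G)
  let := hφ.chartedSpace
  have := hφ.hasTranslationAtlas
  have := hφ.lieGroup hcomm
  have : IsManifold (𝓡 m) 1 (G ⧸ commutator G) := HasTranslationAtlas.isManifold _ _ 1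
  obtain ⟨hsm, hd⟩ := hφ.contMDiff_of_isLocalPrimitive hη hf
    (QuotientGroup.mk' (commutator G)) continuous_quotient_mk' h
  have hs : ∀ g : G, Function.Surjective
      (mfderiv 𝓘(ℝ, E) (𝓡 m) (QuotientGroup.mk : G → G ⧸ commutator G) g) := by
    intro g w
    obtain ⟨v, hv⟩ := hη.surjective (surjective_vectorForm_one b) g w
    exact ⟨v, (hd g v).trans hv⟩
  exact ⟨m, inferInstance, inferInstance, hsm, hs,
    fun α hα ↦ existsUnique_isPullback QuotientGroup.mk_surjective hs hd hα,
    translationConnection _ _, contMDiffCovariantDerivative_translationConnection,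
    hη.projectsTo_translationConnection hsm hd, isFlatConnection_translationConnection,
    fun k b' θ hθ ↦
      isFlatCoordinateSystem_of_isPullback QuotientGroup.mk_surjective hs hd b' hθ⟩
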